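/- Fix integers $n\ge 2$ and $b\ge 1$. Let $\pi_0$ be the identity permutation of $[n]=\{1,\dots,n\}$, and obtain $\pi_t$ from $\pi_{t-1}$ for $t=1,2,\dots$ as follows. Step $t$ is a sorting step if $t\equiv 1 \pmod{b+1}$, and a mixing step otherwise (so every sorting step is followed by exactly $b$ mixing steps). In every step an index $i\in[n-1]$ is sampled uniformly at random, independently of all other steps. In a sorting step (Naïve Sort), the entries $\pi_{t-1}(i)$ and $\pi_{t-1}(i+1)$ are swapped if $\pi_{t-1}(i)>\pi_{t-1}(i+1)$, and nothing changes otherwise. In a mixing step (random adjacent rank swap), the values $i$ and $i+1$ are exchanged in $\pi_{t-1}$, i.e. $\pi_t^{-1}$ is $\pi_{t-1}^{-1}$ with its entries at $i$ and $i+1$ swapped. For a permutation $\pi$ of $[n]$ let $$\mathrm{mdev}(\pi)=\max_{i\in[n]}|\pi(i)-i|,\qquad \mathrm{dev}(\pi)=\sum_{i\in[n]}|\pi(i)-i|$$ be its maximum and total deviation. Let $\log$ denote the natural logarithm. Then there is a function $\delta:\mathbb N\to\mathbb R$ with $\delta(n)\to 0$ as $n\to\infty$ such that for all integers $n\ge 2$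 and all integers $b$ with $1\le b\le n/\log^2 n$: (i) for $m=\frac1{100}(b+1)^2\,n\log n$, $$\Pr\Big[\bigcup_{t\in\mathbb N,\ 1\le t\le m}\Big\{\mathrm{mdev}(\pi_t)\ge \tfrac{1}{800}(b+1)\log n\Big\}\Big]\ \ge\ 1-\delta(n);$$ (ii) for $m=\big\lfloor\frac1{100}(b+1)^2\,n\big\rfloor$, $$\Pr\Big[\mathrm{dev}(\pi_m)\ge \tfrac{1}{1600}(b+1)\,n\Big]\ \ge\ 1-\delta(n).$$ -/

import Mathlib

open MeasureTheory ProbabilityTheory Filter Topology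

namespace NaiveSort

/-- `swapAt π i j` is the permutation `π` with the values `π i` and `π j` exchanged. -/
def swapAt {n : ℕ} (π : Equiv.Perm (Fin n)) (i j : Fin n) : Equiv.Perm (Fin n) :=
  π * Equiv.swap i j

theorem swapAt_left {n : ℕ} (π : Equiv.Perm (Fin n)) (i j : Fin n) :
    swapAt π i j i = π j := by simp [swapAt]

theorem swapAt_right {n : ℕ} (π : Equiv.Perm (Fin n)) (i j : Fin n) :
    swapAt π i j j = π i := by simp [swapAt]

theorem swapAt_of_ne {n : ℕ} (π : Equiv.Perm (Fin n)) (i j k : Fin n)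
    (hi : k ≠ i) (hj : k ≠ j) : swapAt π i j k = π k := by
  simp [swapAt, Equiv.swap_apply_of_ne_of_ne hi hj]

/-- The maximum deviation `max_i |π(i) - π'(i)|`. -/
def mdev {n : ℕ} (π π' : Equiv.Perm (Fin n)) : ℕ :=
  Finset.univ.sup fun i => ((π i : ℤ) - (π' i : ℤ)).natAbs

/-- The total deviation (Spearman's footrule) `∑_i |π(i) - π'(i)|`. -/
def dev {n : ℕ} (π π' : Equiv.Perm (Fin n)) : ℕ :=
  ∑ i, ((π i : ℤ) - (π' i : ℤ)).natAbs

/-- An element of `Fin (n - 1)` stands for the adjacent pair `lo i`, `hi i = lo i + 1`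
of elements of `Fin n`. -/
def lo {n : ℕ} (i : Fin (n - 1)) : Fin n := ⟨i, by omega⟩

/-- The upper element of the adjacent pair given by `i`. -/
def hi {n : ℕ} (i : Fin (n - 1)) : Fin n := ⟨i + 1, by omega⟩

/-- Sorting step of Naïve Sort with chosen index `i`: the adjacent entries at positions
`i`, `i + 1` are swapped if they are out of order. -/
def sortingStep {n : ℕ} (i : Fin (n - 1)) (π : Equiv.Perm (Fin n)) : Equiv.Perm (Fin n) :=
  if π (hi i) < π (lo i) then swapAt π (lo i) (hi i) else π

/-- Mixing step (adjacent rank swap) with chosen index `i`: in the inverse permutation, the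
entries at `i`, `i + 1` are swapped; that is, the values `i` and `i + 1` are exchanged in `π`. -/
def mixingStep {n : ℕ} (i : Fin (n - 1)) (π : Equiv.Perm (Fin n)) : Equiv.Perm (Fin n) :=
  (swapAt π⁻¹ (lo i) (hi i))⁻¹

/-- The permutation after `t` steps, started from the sorted permutation, where `c t` is the
index chosen in step `t + 1`. Steps `1`, `(b + 1) + 1`, `2 (b + 1) + 1`, … are sorting steps, and
each of them is followed by exactly `b` mixing steps. -/
def process {n : ℕ} (b : ℕ) (c : ℕ → Fin (n - 1)) : ℕ → Equiv.Perm (Fin n)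
  | 0 => 1
  | t + 1 =>
    if t % (b + 1) = 0 then sortingStep (c t) (process b c t)
    else mixingStep (c t) (process b c t)

end NaiveSort

/-! Mixing multiplies the permutation on the left, sorting multiplies it on the right. Hence
`process_eq`: the state at time t is M·S, where M is the product of the mixing transpositions and S
that of the effective sorting transpositions. M is the plain random walk by adjacent transpositions,
unaffected by sorting. The chip that starts at j has value M j and sits at position S⁻¹ j, so the
deviation there is at least |M j − j| − |S⁻¹ j − j|. The proof shows that mixing carries values
further than sorting can carry positions. Write B = b + 1 and L = log n.

Maximum deviation: at the final time alone, the expected number N of chips with |M j − j| ≥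
(101/4000)BL is at least n^0.1 / 4. A chip is touched by at most 2 of the n − 1 sorting choices, so
its position moves about 0.02·BL at most. An exponential moment weighted by the displacement event
(`wordMean_exp_countIn_le`) shows that few displaced chips are touched more than 0.024·BL times; the
others leave a deviation of BL/800.

Total deviation: the mean of ∑ |M j − j| is at least 0.029·Bn if b ≥ 2, while ∑ |S⁻¹ j − j| is at
most twice the number of sorting steps, about 0.02·Bn. For b = 1 this is not enough, and one uses
that early on few adjacent pairs are out of order, so that most sorting steps do nothing.

Two tools supply the estimates for M. Displacements of one value are bounded below by explicit
subsolutions of the discrete heat equation (`le_chipOp_iterate`): a quartic for the mean and a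
combination of cosh's for the tail. They are nonpositive far from the start, so the ends of [n] do
not interfere. Sums over chips concentrate by Chebyshev, since `permOp_iterate_sq_le` bounds their
variance by four times the sum of the single variances. -/

namespace NaiveSort

/-! ### Averages over finite words -/

section Words

/-- The uniform average of a function on a finite type. -/
noncomputable def mean {X : Type*} [Fintype X] (f : X → ℝ) : ℝ := (∑ x, f x) / Fintype.card X

section Mean
variable {X : Type*} [Fintype X]

theorem mean_mono {f g : X → ℝ} (h : ∀ x, f x ≤ g x) : mean f ≤ mean g := by
  unfold mean
  gcongr with x
  exact h x

theorem mean_add (f g : X → ℝ) : mean (fun x => f x + g x) = mean f + mean g := by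
  simp [mean, Finset.sum_add_distrib, add_div]

theorem mean_sub (f g : X → ℝ) : mean (fun x => f x - g x) = mean f - mean g := by
  simp [mean, Finset.sum_sub_distrib, sub_div]

theorem mean_const_mul (a : ℝ) (f : X → ℝ) : mean (fun x => a * f x) = a * mean f := by
  simp [mean, ← Finset.mul_sum, mul_div_assoc]

theorem mean_mul_const (a : ℝ) (f : X → ℝ) : mean (fun x => f x * a) = mean f * a := by
  simp only [mul_comm _ a, mean_const_mul]

theorem mean_const [Nonempty X] (a : ℝ) : mean (fun _ : X => a) = a := by
  simp [mean]

theorem mean_sum {ι : Type*} (s : Finset ι) (f : ι → X → ℝ) :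
    mean (fun x => ∑ i ∈ s, f i x) = ∑ i ∈ s, mean (f i) := by
  simp only [mean]
  rw [Finset.sum_comm, Finset.sum_div]

theorem mean_nonneg {f : X → ℝ} (h : ∀ x, 0 ≤ f x) : 0 ≤ mean f :=
  div_nonneg (Finset.sum_nonneg fun x _ => h x) (Nat.cast_nonneg _)

end Mean

variable {X : Type*}

/-- The infinite word obtained from a finite one by repeating the letter `x₀`. -/
def pad (x₀ : X) {m : ℕ} (c : Fin m → X) : ℕ → X :=
  fun t => if h : t < m then c ⟨t, h⟩ else x₀

theorem pad_snoc (x₀ : X) {m : ℕ} (c : Fin m → X) (x : X) :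
    pad x₀ (Fin.snoc c x : Fin (m + 1) → X) = Function.update (pad x₀ c) m x := by
  funext t
  rcases lt_trichotomy t m with h | rfl | h
  · simp [pad, Fin.snoc, h, h.ne, Nat.lt_succ_of_lt h]
  · simp [pad, Fin.snoc]
  · simp [pad, h.ne', not_lt.2 h.le, show ¬ t < m + 1 by omega]

variable [Fintype X]

/-- The average of a function of infinite words over the first `m` letters. -/
noncomputable def wordMean (x₀ : X) (m : ℕ) (F : (ℕ → X) → ℝ) : ℝ :=
  mean fun c : Fin m → X => F (pad x₀ c)

theorem wordMean_zero (x₀ : X) (F : (ℕ → X) → ℝ) : wordMean x₀ 0 F = F fun _ => x₀ := by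
  have : pad x₀ (default : Fin 0 → X) = fun _ => x₀ := by funext t; simp [pad]
  simp [wordMean, mean, this]

/-- Conditioning on the first m letters: the last letter is averaged first. This drives every
induction on time below. -/
theorem wordMean_succ (x₀ : X) (m : ℕ) (F : (ℕ → X) → ℝ) :
    wordMean x₀ (m + 1) F =
      wordMean x₀ m fun c => mean fun x => F (Function.update c m x) := by
  simp only [wordMean, mean, ← pad_snoc]
  rw [← Fintype.sum_equiv (Fin.snocEquiv fun _ => X)
    (fun p => F (pad x₀ (Fin.snoc p.2 p.1 : Fin (m + 1) → X))) _ (fun p => rfl),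
    Fintype.sum_prod_type_right, ← Finset.sum_div, div_div]
  congr 1
  simp [pow_succ, mul_comm]

theorem wordMean_mono (x₀ : X) (m : ℕ) {F G : (ℕ → X) → ℝ} (h : ∀ c, F c ≤ G c) :
    wordMean x₀ m F ≤ wordMean x₀ m G :=
  mean_mono fun _ => h _

theorem wordMean_sub (x₀ : X) (m : ℕ) (F G : (ℕ → X) → ℝ) :
    wordMean x₀ m (fun c => F c - G c) = wordMean x₀ m F - wordMean x₀ m G :=
  mean_sub _ _

theorem wordMean_const_mul (x₀ : X) (m : ℕ) (a : ℝ) (F : (ℕ → X) → ℝ) :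
    wordMean x₀ m (fun c => a * F c) = a * wordMean x₀ m F :=
  mean_const_mul _ _

theorem wordMean_const (x₀ : X) (m : ℕ) (a : ℝ) : wordMean x₀ m (fun _ => a) = a :=
  have : Nonempty X := ⟨x₀⟩
  mean_const a

theorem wordMean_sum {ι : Type*} (x₀ : X) (m : ℕ) (s : Finset ι) (F : ι → (ℕ → X) → ℝ) :
    wordMean x₀ m (fun c => ∑ i ∈ s, F i c) = ∑ i ∈ s, wordMean x₀ m (F i) :=
  mean_sum _ _

open Classical in
/-- A statement about the first `m` letters of a uniformly random word has the probability that
is given by averaging over all finite words. -/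
theorem wordMean_le_measureReal {Ω : Type*} [MeasurableSpace Ω] (μ : Measure Ω)
    [IsProbabilityMeasure μ] [MeasurableSpace X] [MeasurableSingletonClass X] (I : ℕ → Ω → X)
    (hI : ∀ t, Measurable (I t)) (hind : iIndepFun I μ)
    (hunif : ∀ t i, μ.real {ω | I t ω = i} = 1 / (Fintype.card X : ℝ)) (x₀ : X) (m : ℕ)
    (E : (ℕ → X) → Prop) (hE : ∀ c c' : ℕ → X, (∀ t < m, c t = c' t) → (E c ↔ E c'))
    (D : Set Ω) (hD : ∀ ω, E (fun t => I t ω) → ω ∈ D) :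
    wordMean x₀ m (fun c => if E c then 1 else 0) ≤ μ.real D := by
  set W : Finset (Fin m → X) := Finset.univ.filter fun c => E (pad x₀ c)
  let U : (Fin m → X) → Set Ω := fun c => ⋂ t ∈ (Finset.univ : Finset (Fin m)), I t ⁻¹' {c t}
  have hUmem : ∀ c ω, ω ∈ U c ↔ ∀ t : Fin m, I t ω = c t := fun c ω => by simp [U]
  have hUm : ∀ c, MeasurableSet (U c) := fun c =>
    Finset.measurableSet_biInter _ fun t _ => hI t (measurableSet_singleton _)
  have hind' : iIndepFun (fun t : Fin m => I t) μ := hind.precomp Fin.val_injective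
  have hUμ : ∀ c, μ.real (U c) = 1 / (Fintype.card X : ℝ) ^ m := fun c => by
    rw [measureReal_def, hind'.measure_inter_preimage_eq_mul Finset.univ
      (fun t _ => measurableSet_singleton _), ENNReal.toReal_prod]
    have : ∀ t : Fin m, (μ (I t ⁻¹' {c t})).toReal = 1 / (Fintype.card X : ℝ) :=
      fun t => hunif t (c t)
    simp [this]
  have hdisj : Set.PairwiseDisjoint (W : Set (Fin m → X)) U := by
    intro c _ c' _ hne
    refine Set.disjoint_left.2 fun ω h h' => hne ?_
    funext t
    rw [← (hUmem c ω).1 h t, (hUmem c' ω).1 h' t]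
  have hsub : (⋃ c ∈ W, U c) ⊆ D := by
    intro ω hω
    simp only [Set.mem_iUnion] at hω
    obtain ⟨c, hc, hω⟩ := hω
    refine hD ω ((hE _ _ fun t ht => ?_).1 (Finset.mem_filter.1 hc).2)
    simp [pad, ht, (hUmem c ω).1 hω ⟨t, ht⟩]
  calc wordMean x₀ m (fun c => if E c then 1 else 0)
      = ∑ c ∈ W, μ.real (U c) := by
        simp [wordMean, mean, W, hUμ, div_eq_mul_inv]
    _ = μ.real (⋃ c ∈ W, U c) := (measureReal_biUnion_finset hdisj fun c _ => hUm c).symm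
    _ ≤ μ.real D := measureReal_mono hsub

end Words

/-! ### The adjacent transposition walk -/

section Walk

variable {n : ℕ}

/-- The adjacent transposition with index `x`. -/
def adj (x : Fin (n - 1)) : Equiv.Perm (Fin n) := Equiv.swap (lo x) (hi x)

theorem adj_apply_of_ne {x : Fin (n - 1)} {v : Fin n} (h : ¬ (v = lo x ∨ v = hi x)) :
    adj x v = v := by
  push Not at h
  exact Equiv.swap_apply_of_ne_of_ne h.1 h.2

theorem lo_injective : Function.Injective (lo (n := n)) := fun x y h => by
  simpa [lo, Fin.ext_iff] using h

theorem hi_injective : Function.Injective (hi (n := n)) := fun x y h => by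
  simpa [hi, Fin.ext_iff] using h

/-- One step of the walk of a single value, acting on functions. -/
noncomputable def chipOp (f : Fin n → ℝ) : Fin n → ℝ :=
  fun v => mean fun x : Fin (n - 1) => f (adj x v)

/-- One step of the walk on permutations, acting on functions. -/
noncomputable def permOp (g : Equiv.Perm (Fin n) → ℝ) : Equiv.Perm (Fin n) → ℝ :=
  fun π => mean fun x : Fin (n - 1) => g (adj x * π)

theorem chipOp_mono {f g : Fin n → ℝ} (h : ∀ v, f v ≤ g v) (v : Fin n) :
    chipOp f v ≤ chipOp g v :=
  mean_mono fun _ => h _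

theorem permOp_mono {f g : Equiv.Perm (Fin n) → ℝ} (h : ∀ v, f v ≤ g v) (v : Equiv.Perm (Fin n)) :
    permOp f v ≤ permOp g v :=
  mean_mono fun _ => h _

theorem chipOp_iterate_nonneg (k : ℕ) {f : Fin n → ℝ} (h : ∀ v, 0 ≤ f v) (v : Fin n) :
    0 ≤ chipOp^[k] f v := by
  induction k generalizing f with
  | zero => exact h v
  | succ k ih => exact ih fun v => mean_nonneg fun _ => h _

theorem permOp_iterate_mono (k : ℕ) {f g : Equiv.Perm (Fin n) → ℝ} (h : ∀ v, f v ≤ g v)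
    (v : Equiv.Perm (Fin n)) : permOp^[k] f v ≤ permOp^[k] g v := by
  induction k generalizing f g with
  | zero => exact h v
  | succ k ih => exact ih (permOp_mono h)

theorem permOp_iterate_add (k : ℕ) (f g : Equiv.Perm (Fin n) → ℝ) :
    permOp^[k] (fun π => f π + g π) = fun π => permOp^[k] f π + permOp^[k] g π := by
  induction k generalizing f g with
  | zero => rfl
  | succ k ih =>
    rw [Function.iterate_succ_apply, Function.iterate_succ_apply, Function.iterate_succ_apply,
      ← ih]
    congr 1
    funext π
    exact mean_add _ _

theorem permOp_iterate_const_mul (k : ℕ) (a : ℝ) (f : Equiv.Perm (Fin n) → ℝ) :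
    permOp^[k] (fun π => a * f π) = fun π => a * permOp^[k] f π := by
  induction k generalizing f with
  | zero => rfl
  | succ k ih =>
    rw [Function.iterate_succ_apply, Function.iterate_succ_apply, ← ih]
    congr 1
    funext π
    exact mean_const_mul _ _

theorem permOp_iterate_const (hn : 2 ≤ n) (k : ℕ) (a : ℝ) (π : Equiv.Perm (Fin n)) :
    permOp^[k] (fun _ => a) π = a := by
  have : Nonempty (Fin (n - 1)) := ⟨⟨0, by omega⟩⟩
  induction k with
  | zero => rfl
  | succ k ih =>
    rw [Function.iterate_succ_apply, show permOp (fun _ : Equiv.Perm (Fin n) => a) = fun _ => a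
      from funext fun π => mean_const a, ih]

theorem permOp_sum (φ : Fin n → Fin n → ℝ) :
    permOp (fun π => ∑ j, φ j (π j)) = fun π => ∑ j, chipOp (φ j) (π j) :=
  funext fun _ => mean_sum _ _

theorem permOp_iterate_sum (k : ℕ) (φ : Fin n → Fin n → ℝ) :
    permOp^[k] (fun π => ∑ j, φ j (π j)) = fun π => ∑ j, chipOp^[k] (φ j) (π j) := by
  induction k generalizing φ with
  | zero => rfl
  | succ k ih => rw [Function.iterate_succ_apply, permOp_sum, ih]; rfl

theorem sq_sum_le_two_mul {ι : Type*} [Fintype ι] [DecidableEq ι] {f : ι → ℝ} (s : Finset ι)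
    (hs : s.card ≤ 2) (hf : ∀ i, i ∉ s → f i = 0) : (∑ i, f i) ^ 2 ≤ 2 * ∑ i, f i ^ 2 := by
  have h1 : ∑ i, f i = ∑ i ∈ s, f i :=
    (Finset.sum_subset (Finset.subset_univ s) fun i _ h => hf i h).symm
  have h2 : ∑ i, f i ^ 2 = ∑ i ∈ s, f i ^ 2 :=
    (Finset.sum_subset (Finset.subset_univ s) fun i _ h => by simp [hf i h]).symm
  rw [h1, h2]
  refine sq_sum_le_card_mul_sum_sq.trans ?_
  exact mul_le_mul_of_nonneg_right (by exact_mod_cast hs)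
    (Finset.sum_nonneg fun i _ => sq_nonneg _)

theorem card_touching_le (v : Fin n) :
    (Finset.univ.filter fun x : Fin (n - 1) => v = lo x ∨ v = hi x).card ≤ 2 := by
  rw [Finset.filter_or]
  refine (Finset.card_union_le _ _).trans (Nat.add_le_add (b := 1) (d := 1) ?_ ?_)
  · refine Finset.card_le_one.2 fun x hx y hy => lo_injective ?_
    simp only [Finset.mem_filter, Finset.mem_univ, true_and] at hx hy
    rw [← hx, ← hy]
  · refine Finset.card_le_one.2 fun x hx y hy => hi_injective ?_
    simp only [Finset.mem_filter, Finset.mem_univ, true_and] at hx hy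
    rw [← hx, ← hy]

theorem card_touched_le (π : Equiv.Perm (Fin n)) (x : Fin (n - 1)) :
    (Finset.univ.filter fun j : Fin n => π j = lo x ∨ π j = hi x).card ≤ 2 := by
  rw [Finset.filter_or]
  refine (Finset.card_union_le _ _).trans (Nat.add_le_add (b := 1) (d := 1) ?_ ?_)
  · refine Finset.card_le_one.2 fun x hx y hy => π.injective ?_
    simp only [Finset.mem_filter, Finset.mem_univ, true_and] at hx hy
    rw [hx, hy]
  · refine Finset.card_le_one.2 fun x hx y hy => π.injective ?_
    simp only [Finset.mem_filter, Finset.mem_univ, true_and] at hx hy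
    rw [hx, hy]

theorem mean_sq_sub_sq_mean {X : Type*} [Fintype X] [Nonempty X] (f : X → ℝ) (a : ℝ) :
    mean (fun x => f x ^ 2) - mean f ^ 2 =
      mean (fun x => (f x - a) ^ 2) - mean (fun x => f x - a) ^ 2 := by
  have h : mean (fun x => (f x - a) ^ 2) = mean (fun x => f x ^ 2) - 2 * a * mean f + a ^ 2 := by
    rw [← mean_const_mul, ← mean_sub, ← mean_const (X := X) (a ^ 2), ← mean_add]
    congr 1
    funext x
    ring
  rw [h, mean_sub, mean_const]
  ring

/-- One transposition moves at most two chips, so the square of the total increment is at most twice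
the sum of the squares. Conversely a chip is moved by at most 2 of the n − 1 ≥ 4 indices, so its
squared mean increment is at most half its mean squared increment, and its variance is at least the
other half. The two factors 2 give the 4. -/
theorem permOp_sq_sub_le (hn : 5 ≤ n) (φ : Fin n → Fin n → ℝ) (π : Equiv.Perm (Fin n)) :
    permOp (fun π => (∑ j, φ j (π j)) ^ 2) π - (permOp (fun π => ∑ j, φ j (π j)) π) ^ 2 ≤
      4 * ∑ j, (chipOp (fun v => φ j v ^ 2) (π j) - (chipOp (φ j) (π j)) ^ 2) := by
  have : Nonempty (Fin (n - 1)) := ⟨⟨0, by omega⟩⟩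
  set d : Fin n → Fin (n - 1) → ℝ := fun j x => φ j (adj x (π j)) - φ j (π j) with hd
  have hd0 : ∀ j x, ¬ (π j = lo x ∨ π j = hi x) → d j x = 0 := fun j x h => by
    simp [hd, adj_apply_of_ne h]
  have h1 : permOp (fun π => (∑ j, φ j (π j)) ^ 2) π - (permOp (fun π => ∑ j, φ j (π j)) π) ^ 2 ≤
      2 * ∑ j, mean fun x => d j x ^ 2 := by
    unfold permOp
    rw [mean_sq_sub_sq_mean _ (∑ j, φ j (π j))]
    have : mean (fun x : Fin (n - 1) => (∑ j, φ j ((adj x * π) j) - ∑ j, φ j (π j)) ^ 2) ≤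
        mean fun x => 2 * ∑ j, d j x ^ 2 := by
      refine mean_mono fun x => ?_
      rw [← Finset.sum_sub_distrib]
      refine sq_sum_le_two_mul _ (card_touched_le π x) fun j hj => hd0 j x ?_
      simpa using hj
    rw [mean_const_mul, mean_sum] at this
    linarith [sq_nonneg (mean fun x : Fin (n - 1) => ∑ j, φ j ((adj x * π) j) - ∑ j, φ j (π j))]
  have h2 : ∀ j, (1 / 2) * mean (fun x => d j x ^ 2) ≤
      chipOp (fun v => φ j v ^ 2) (π j) - (chipOp (φ j) (π j)) ^ 2 := fun j => by
    unfold chipOp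
    rw [mean_sq_sub_sq_mean _ (φ j (π j))]
    have hs : (∑ x, d j x) ^ 2 ≤ 2 * ∑ x, d j x ^ 2 :=
      sq_sum_le_two_mul _ (card_touching_le (π j)) fun x hx => hd0 j x (by simpa using hx)
    have hN : (4 : ℝ) ≤ Fintype.card (Fin (n - 1)) := by
      rw [Fintype.card_fin]; exact_mod_cast (by omega : 4 ≤ n - 1)
    have hm : mean (fun x => d j x) ^ 2 ≤ 1 / 2 * mean (fun x => d j x ^ 2) := by
      unfold mean
      set N : ℝ := (Fintype.card (Fin (n - 1)) : ℝ)
      have hS : 0 ≤ ∑ x, d j x ^ 2 := Finset.sum_nonneg fun x _ => sq_nonneg _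
      rw [div_pow, div_le_iff₀ (by positivity)]
      have : 1 / 2 * ((∑ x, d j x ^ 2) / N) * N ^ 2 = 1 / 2 * (∑ x, d j x ^ 2) * N := by
        field_simp
      rw [this]
      nlinarith
    linarith
  have h3 := Finset.sum_le_sum fun j (_ : j ∈ Finset.univ) => h2 j
  rw [← Finset.mul_sum] at h3
  linarith

/-- The variance of an additive functional of the walk on permutations is at most four times
the sum of the variances of its summands. -/
theorem permOp_iterate_sq_le (hn : 5 ≤ n) (k : ℕ) (φ : Fin n → Fin n → ℝ)
    (π : Equiv.Perm (Fin n)) :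
    permOp^[k] (fun π => (∑ j, φ j (π j)) ^ 2) π ≤ (permOp^[k] (fun π => ∑ j, φ j (π j)) π) ^ 2 +
      4 * ∑ j, (chipOp^[k] (fun v => φ j v ^ 2) (π j) - (chipOp^[k] (φ j) (π j)) ^ 2) := by
  induction k generalizing φ with
  | zero => simp
  | succ k ih =>
    simp only [Function.iterate_succ_apply]
    -- Law of total variance: averaging the last step turns the summands `φ j` into `chipOp (φ j)`,
    -- so the functional stays additive and the single-chip variances telescope.
    have h1 : ∀ π, permOp (fun π => (∑ j, φ j (π j)) ^ 2) π ≤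
        (∑ j, chipOp (φ j) (π j)) ^ 2 + (4 * ∑ j, chipOp (fun v => φ j v ^ 2) (π j) +
          (-4) * ∑ j, (chipOp (φ j) (π j)) ^ 2) := fun π => by
      have := permOp_sq_sub_le hn φ π
      rw [permOp_sum, Finset.sum_sub_distrib] at this
      linarith
    refine (permOp_iterate_mono k h1 π).trans ?_
    have h2 := ih fun j => chipOp (φ j)
    rw [permOp_iterate_add, permOp_iterate_add, permOp_iterate_const_mul,
      permOp_iterate_const_mul, permOp_sum,
      permOp_iterate_sum k fun j => chipOp fun v => φ j v ^ 2,
      permOp_iterate_sum k fun j v => (chipOp (φ j) v) ^ 2]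
    simp only [Finset.sum_sub_distrib] at h2 ⊢
    linarith

/-- The variance bound in the form of Chebyshev's inequality. -/
theorem permOp_iterate_chebyshev (hn : 5 ≤ n) (k : ℕ) (φ : Fin n → Fin n → ℝ)
    (π : Equiv.Perm (Fin n)) {g : ℝ} (hg : 0 < g) {V m : ℝ}
    (hV : ∑ j, chipOp^[k] (fun v => φ j v ^ 2) (π j) ≤ V)
    (hm : ∑ j, chipOp^[k] (φ j) (π j) = m) :
    permOp^[k] (fun σ => if ∑ j, φ j (σ j) ≤ m - g then 1 else 0) π ≤ 4 * V / g ^ 2 := by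
  have hE : permOp^[k] (fun π => ∑ j, φ j (π j)) π = m := by rw [permOp_iterate_sum, ← hm]
  -- Markov's inequality for (m − ∑)², with the square expanded so that the operator can be applied
  -- term by term.
  have h1 : ∀ σ : Equiv.Perm (Fin n), (if ∑ j, φ j (σ j) ≤ m - g then (1 : ℝ) else 0) ≤
      (1 / g ^ 2) * ((∑ j, φ j (σ j)) ^ 2 + ((-2 * m) * ∑ j, φ j (σ j) + m ^ 2)) := fun σ => by
    have e : (∑ j, φ j (σ j)) ^ 2 + ((-2 * m) * ∑ j, φ j (σ j) + m ^ 2) =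
      (m - ∑ j, φ j (σ j)) ^ 2 := by ring
    rw [e, one_div, ← div_eq_inv_mul]
    split_ifs with h
    · rw [le_div_iff₀ (by positivity), one_mul]
      exact pow_le_pow_left₀ hg.le (by linarith) 2
    · positivity
  refine (permOp_iterate_mono k h1 π).trans ?_
  rw [permOp_iterate_const_mul, permOp_iterate_add, permOp_iterate_add, permOp_iterate_const_mul]
  dsimp only
  rw [permOp_iterate_const (by omega), hE, one_div, ← div_eq_inv_mul]
  have h2 := permOp_iterate_sq_le hn k φ π
  rw [hE, Finset.sum_sub_distrib] at h2
  have h3 : 0 ≤ ∑ j, (chipOp^[k] (φ j) (π j)) ^ 2 := Finset.sum_nonneg fun j _ => sq_nonneg _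
  gcongr
  linarith

/-- One step of the walk of a single value, applied to a function of the displacement. -/
theorem chipOp_shift (hn : 2 ≤ n) (f : ℤ → ℝ) (j : ℤ) (v : Fin n) :
    chipOp (fun v : Fin n => f ((v : ℤ) - j)) v = f ((v : ℤ) - j) +
      ((if (v : ℕ) + 1 < n then f ((v : ℤ) - j + 1) - f ((v : ℤ) - j) else 0) +
        (if 0 < (v : ℕ) then f ((v : ℤ) - j - 1) - f ((v : ℤ) - j) else 0)) / ((n : ℝ) - 1) := by
  have : Nonempty (Fin (n - 1)) := ⟨⟨0, by omega⟩⟩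
  have hcard : (Fintype.card (Fin (n - 1)) : ℝ) = (n : ℝ) - 1 := by
    rw [Fintype.card_fin, Nat.cast_sub (by omega), Nat.cast_one]
  have h1 : chipOp (fun v : Fin n => f ((v : ℤ) - j)) v = f ((v : ℤ) - j) +
      mean fun x : Fin (n - 1) => f ((adj x v : Fin n) - j) - f ((v : ℤ) - j) := by
    rw [mean_sub, mean_const, chipOp]
    ring
  have h2 : ∀ x : Fin (n - 1), f ((adj x v : Fin n) - j) - f ((v : ℤ) - j) =
      (if v = lo x then f ((v : ℤ) - j + 1) - f ((v : ℤ) - j) else 0) +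
        (if v = hi x then f ((v : ℤ) - j - 1) - f ((v : ℤ) - j) else 0) := fun x => by
    by_cases hl : v = lo x
    · have hh : v ≠ hi x := by simp [hl, lo, hi]
      rw [if_pos hl, if_neg hh, hl, adj, Equiv.swap_apply_left, add_zero]
      congr 2
      simp [hi, lo]
      ring
    · by_cases hh : v = hi x
      · rw [if_neg hl, if_pos hh, hh, adj, Equiv.swap_apply_right, zero_add]
        congr 2
        simp [hi, lo]
        ring
      · simp [adj_apply_of_ne (not_or.2 ⟨hl, hh⟩), hl, hh]
  have h3 : ∀ a : ℝ, ∑ x : Fin (n - 1), (if v = lo x then a else 0) =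
      if (v : ℕ) + 1 < n then a else 0 := fun a => by
    split_ifs with h
    · rw [Finset.sum_eq_single ⟨v, by omega⟩]
      · simp [lo]
      · intro x _ hx
        rw [if_neg]
        rintro rfl
        exact hx (by simp [lo])
      · simp
    · refine Finset.sum_eq_zero fun x _ => if_neg ?_
      rintro rfl
      exact h (by have := x.2; simp [lo]; omega)
  have h4 : ∀ a : ℝ, ∑ x : Fin (n - 1), (if v = hi x then a else 0) =
      if 0 < (v : ℕ) then a else 0 := fun a => by
    split_ifs with h
    · rw [Finset.sum_eq_single ⟨v - 1, by omega⟩]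
      · simp only [hi, Fin.ext_iff]
        rw [if_pos (by omega)]
      · intro x _ hx
        rw [if_neg]
        rintro rfl
        exact hx (by simp [hi])
      · simp
    · refine Finset.sum_eq_zero fun x _ => if_neg ?_
      rintro rfl
      exact h (by simp [hi])
  rw [h1]
  simp only [h2]
  rw [mean, Finset.sum_add_distrib, h3, h4, hcard]

/-- Comparison of the walk of a single value with a subsolution for the walk on the integers that
is positive only away from the ends. -/
theorem le_chipOp_iterate (hn : 3 ≤ n) (W : ℝ) (k : ℕ) (u : ℕ → ℤ → ℝ)
    (hu : ∀ s < k, ∀ d : ℤ,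
      u (s + 1) d ≤ u s d + (u s (d + 1) + u s (d - 1) - 2 * u s d) / ((n : ℝ) - 1))
    (hW : ∀ s ≤ k, ∀ d : ℤ, W ≤ |(d : ℝ)| → u s d ≤ 0)
    (φ : ℤ → ℝ) (hφ : ∀ d, 0 ≤ φ d) (hφu : ∀ d, u 0 d ≤ φ d) (j : Fin n)
    (hj : W ≤ (j : ℕ)) (hj' : (j : ℕ) + W ≤ (n : ℝ) - 1) :
    u k 0 ≤ chipOp^[k] (fun v : Fin n => φ ((v : ℤ) - (j : ℕ))) j := by
  suffices H : ∀ s ≤ k, ∀ v : Fin n,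
      u s ((v : ℤ) - (j : ℕ)) ≤ chipOp^[s] (fun v : Fin n => φ ((v : ℤ) - (j : ℕ))) v by
    simpa using H k le_rfl j
  intro s
  induction s with
  | zero => exact fun _ v => hφu _
  | succ s ih =>
    intro hs v
    have hpos : 0 ≤ chipOp^[s + 1] (fun v : Fin n => φ ((v : ℤ) - (j : ℕ))) v :=
      chipOp_iterate_nonneg _ (fun v => hφ _) v
    by_cases hv : (v : ℕ) + 1 < n ∧ 0 < (v : ℕ)
    · rw [Function.iterate_succ_apply']
      refine le_trans ?_ (chipOp_mono (ih (by omega)) v)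
      rw [chipOp_shift (by omega), if_pos hv.1, if_pos hv.2]
      refine (hu s (by omega) _).trans (le_of_eq ?_)
      ring
    -- At either end of [n] the displacement from j is at least W in modulus, so u ≤ 0 and
    -- nonnegativity of the iterate suffices.
    · refine (hW _ hs _ ?_).trans hpos
      rcases not_and_or.1 hv with h | h
      · have : ((v : ℕ) : ℝ) + 1 = n := by exact_mod_cast (by omega : (v : ℕ) + 1 = n)
        push_cast
        exact le_trans (by linarith) (le_abs_self _)
      · have : (v : ℕ) = 0 := by omega
        push_cast
        rw [this, abs_sub_comm]
        exact le_trans (by push_cast; linarith) (le_abs_self _)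

/-- The mean square displacement of a single value. -/
theorem chipOp_iterate_sq_le (hn : 2 ≤ n) (k : ℕ) (j v : Fin n) :
    chipOp^[k] (fun v : Fin n => (((v : ℤ) - (j : ℕ) : ℤ) : ℝ) ^ 2) v ≤
      (((v : ℤ) - (j : ℕ) : ℤ) : ℝ) ^ 2 + k * (2 / ((n : ℝ) - 1)) := by
  have : Nonempty (Fin (n - 1)) := ⟨⟨0, by omega⟩⟩
  have hn' : (0 : ℝ) < (n : ℝ) - 1 := by
    have : (2 : ℝ) ≤ n := by exact_mod_cast hn
    linarith
  induction k generalizing v with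
  | zero => simp
  | succ k ih =>
    rw [Function.iterate_succ_apply']
    refine (chipOp_mono ih v).trans ?_
    have e := chipOp_shift hn (fun d : ℤ => (d : ℝ) ^ 2 + k * (2 / ((n : ℝ) - 1))) (j : ℕ) v
    rw [e]
    have key : ((if (v : ℕ) + 1 < n then ((((v : ℤ) - (j : ℕ) + 1 : ℤ) : ℝ) ^ 2 +
          k * (2 / ((n : ℝ) - 1))) - ((((v : ℤ) - (j : ℕ) : ℤ) : ℝ) ^ 2 +
          k * (2 / ((n : ℝ) - 1))) else 0) +
        (if 0 < (v : ℕ) then ((((v : ℤ) - (j : ℕ) - 1 : ℤ) : ℝ) ^ 2 +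
          k * (2 / ((n : ℝ) - 1))) - ((((v : ℤ) - (j : ℕ) : ℤ) : ℝ) ^ 2 +
          k * (2 / ((n : ℝ) - 1))) else 0)) ≤ 2 := by
      push_cast
      have hjn : ((j : ℕ) : ℝ) + 1 ≤ n := by exact_mod_cast j.2
      have hj0 : (0 : ℝ) ≤ (j : ℕ) := Nat.cast_nonneg _
      -- In the interior the two increments add up to exactly 2. At an end only the inward move is
      -- left, and the displacement from j has the sign that makes its increment at most 1.
      split_ifs with h1 h2 h2
      · nlinarith
      · have h0 : ((v : ℕ) : ℝ) = 0 := by exact_mod_cast (by omega : (v : ℕ) = 0)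
        nlinarith
      · have h0 : ((v : ℕ) : ℝ) + 1 = n := by
          exact_mod_cast (by have := v.2; omega : (v : ℕ) + 1 = n)
        nlinarith
      · norm_num
    have := div_le_div_of_nonneg_right key hn'.le
    push_cast at this ⊢
    linarith

end Walk

/-! ### Separating the mixing steps from the sorting steps -/

section Parts

variable {n : ℕ}

/-- The product of the transpositions of values applied in the first `t` steps. -/
def mixPart (b : ℕ) (c : ℕ → Fin (n - 1)) : ℕ → Equiv.Perm (Fin n)
  | 0 => 1
  | t + 1 => if t % (b + 1) = 0 then mixPart b c t else adj (c t) * mixPart b c t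

/-- The indices whose choice makes a sorting step in step `t + 1` effective. -/
def activeSet (b : ℕ) (c : ℕ → Fin (n - 1)) (t : ℕ) : Finset (Fin (n - 1)) :=
  Finset.univ.filter fun x => process b c t (hi x) < process b c t (lo x)

/-- The product of the transpositions of positions applied in the first `t` steps. -/
def sortPart (b : ℕ) (c : ℕ → Fin (n - 1)) : ℕ → Equiv.Perm (Fin n)
  | 0 => 1
  | t + 1 => if t % (b + 1) = 0 ∧ c t ∈ activeSet b c t then sortPart b c t * adj (c t)
      else sortPart b c t

/-- The indices whose choice in a sorting step can move the chip that started at `j`. -/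
def touchSet (b : ℕ) (j : Fin n) (c : ℕ → Fin (n - 1)) (t : ℕ) : Finset (Fin (n - 1)) :=
  Finset.univ.filter fun x => (sortPart b c t)⁻¹ j = lo x ∨ (sortPart b c t)⁻¹ j = hi x

/-- The number of sorting steps among the first `t` steps. -/
def numSorts (b : ℕ) : ℕ → ℕ
  | 0 => 0
  | t + 1 => numSorts b t + if t % (b + 1) = 0 then 1 else 0

/-- The number of mixing steps among the first `t` steps. -/
def numMix (b : ℕ) : ℕ → ℕ
  | 0 => 0
  | t + 1 => numMix b t + if t % (b + 1) = 0 then 0 else 1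

/-- The number of sorting steps among the first `t` steps in which the chosen index lies in the
set `A`, which may depend on the history. -/
def countIn {X : Type*} [DecidableEq X] (b : ℕ) (A : (ℕ → X) → ℕ → Finset X) (c : ℕ → X) : ℕ → ℕ
  | 0 => 0
  | t + 1 => countIn b A c t + if t % (b + 1) = 0 ∧ c t ∈ A c t then 1 else 0

theorem numSorts_add_numMix (b t : ℕ) : numSorts b t + numMix b t = t := by
  induction t with
  | zero => rfl
  | succ t ih => simp only [numSorts, numMix]; split_ifs <;> omega

/-- Together the two bounds say that the count is ⌈t / (b + 1)⌉. -/
theorem numSorts_bounds (b t : ℕ) :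
    t ≤ (b + 1) * numSorts b t ∧ (b + 1) * numSorts b t ≤ t + b := by
  induction t with
  | zero => simp [numSorts]
  | succ t ih =>
    simp only [numSorts]
    split_ifs with h
    · obtain ⟨q, rfl⟩ := Nat.dvd_of_mod_eq_zero h
      have h1 : q ≤ numSorts b ((b + 1) * q) := Nat.le_of_mul_le_mul_left ih.1 (by omega)
      have h2 : numSorts b ((b + 1) * q) < q + 1 :=
        Nat.lt_of_mul_lt_mul_left (a := b + 1) (by rw [mul_add]; omega)
      have h3 : numSorts b ((b + 1) * q) = q := by omega
      rw [h3]
      constructor <;> rw [mul_add] <;> omega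
    · have hne : t ≠ (b + 1) * numSorts b t := fun h' => h (by rw [h']; exact Nat.mul_mod_right _ _)
      rw [add_zero]
      omega

theorem countIn_le_numSorts {X : Type*} [DecidableEq X] (b : ℕ) (A : (ℕ → X) → ℕ → Finset X)
    (c : ℕ → X) (t : ℕ) : countIn b A c t ≤ numSorts b t := by
  induction t with
  | zero => exact le_rfl
  | succ t ih =>
    simp only [countIn, numSorts]
    gcongr
    split_ifs <;> simp_all

/-- Left and right multiplications commute, so the two kinds of steps separate although the decision
to sort depends on both. -/
theorem process_eq (b : ℕ) (c : ℕ → Fin (n - 1)) (t : ℕ) :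
    process b c t = mixPart b c t * sortPart b c t := by
  induction t with
  | zero => simp [process, mixPart, sortPart]
  | succ t ih =>
    simp only [process, mixPart, sortPart]
    by_cases h : t % (b + 1) = 0
    · simp only [h, if_true, true_and, sortingStep, swapAt, activeSet, Finset.mem_filter,
        Finset.mem_univ]
      split_ifs
      · rw [← mul_assoc, ← ih]; rfl
      · exact ih
    · simp only [h, if_false, false_and, mixingStep, swapAt, mul_inv_rev, inv_inv, Equiv.swap_inv]
      rw [mul_assoc, ← ih]
      rfl

/-! ### Quantities at time t depend only on the first t letters. -/

section Locality

variable {c c' : ℕ → Fin (n - 1)}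

theorem process_congr (b : ℕ) {t : ℕ} (h : ∀ s < t, c s = c' s) :
    process b c t = process b c' t := by
  induction t with
  | zero => rfl
  | succ t ih => rw [process, process, ih fun s hs => h s (by omega), h t (by omega)]

theorem mixPart_congr (b : ℕ) {t : ℕ} (h : ∀ s < t, c s = c' s) :
    mixPart b c t = mixPart b c' t := by
  induction t with
  | zero => rfl
  | succ t ih => rw [mixPart, mixPart, ih fun s hs => h s (by omega), h t (by omega)]

theorem activeSet_congr (b : ℕ) {t : ℕ} (h : ∀ s < t, c s = c' s) :
    activeSet b c t = activeSet b c' t := by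
  rw [activeSet, activeSet, process_congr b h]

theorem sortPart_congr (b : ℕ) {t : ℕ} (h : ∀ s < t, c s = c' s) :
    sortPart b c t = sortPart b c' t := by
  induction t with
  | zero => rfl
  | succ t ih => rw [sortPart, sortPart, ih fun s hs => h s (by omega), h t (by omega),
      activeSet_congr b fun s hs => h s (by omega)]

theorem touchSet_congr (b : ℕ) (j : Fin n) {t : ℕ} (h : ∀ s < t, c s = c' s) :
    touchSet b j c t = touchSet b j c' t := by
  rw [touchSet, touchSet, sortPart_congr b h]

theorem countIn_congr {X : Type*} [DecidableEq X] (b : ℕ) {A : (ℕ → X) → ℕ → Finset X}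
    (hA : ∀ (c c' : ℕ → X) (t : ℕ), (∀ s < t, c s = c' s) → A c t = A c' t) {c c' : ℕ → X}
    {t : ℕ} (h : ∀ s < t, c s = c' s) : countIn b A c t = countIn b A c' t := by
  induction t with
  | zero => rfl
  | succ t ih => rw [countIn, countIn, ih fun s hs => h s (by omega), h t (by omega),
      hA c c' t fun s hs => h s (by omega)]

end Locality

theorem update_of_lt {X : Type*} (c : ℕ → X) (m : ℕ) (x : X) :
    ∀ s < m, Function.update c m x s = c s :=
  fun _ hs => Function.update_of_ne hs.ne _ _

theorem abs_adj_sub_le (x : Fin (n - 1)) (v : Fin n) :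
    |((adj x v : ℕ) : ℝ) - (v : ℕ)| ≤ if v = lo x ∨ v = hi x then 1 else 0 := by
  split_ifs with h
  · rcases h with rfl | rfl
    · simp [adj, lo, hi]
    · simp [adj, lo, hi]
  · simp [adj_apply_of_ne h]

/-- The position of a chip changes by at most one in a sorting step, and only when the chosen pair
contains it. -/
theorem abs_sortPart_inv_sub_le (b : ℕ) (c : ℕ → Fin (n - 1)) (j : Fin n) (t : ℕ) :
    |(((sortPart b c t)⁻¹ j : ℕ) : ℝ) - (j : ℕ)| ≤ countIn b (touchSet b j) c t := by
  induction t with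
  | zero => simp [sortPart, countIn]
  | succ t ih =>
    simp only [sortPart, countIn]
    by_cases h : t % (b + 1) = 0
    · simp only [h, true_and]
      by_cases ha : c t ∈ activeSet b c t
      · rw [if_pos ha]
        have e : (sortPart b c t * adj (c t))⁻¹ j = adj (c t) ((sortPart b c t)⁻¹ j) := by
          rw [mul_inv_rev, Equiv.Perm.mul_apply, adj, Equiv.swap_inv]
        rw [e]
        have h1 := abs_adj_sub_le (c t) ((sortPart b c t)⁻¹ j)
        have e' : c t ∈ touchSet b j c t ↔
            (sortPart b c t)⁻¹ j = lo (c t) ∨ (sortPart b c t)⁻¹ j = hi (c t) := by simp [touchSet]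
        simp only [e']
        push_cast
        refine (abs_sub_le _ (((sortPart b c t)⁻¹ j : ℕ) : ℝ) _).trans ?_
        linarith
      · rw [if_neg ha]
        push_cast
        split_ifs <;> linarith
    · simpa [h] using ih

theorem sum_abs_sortPart_inv_sub_le (b : ℕ) (c : ℕ → Fin (n - 1)) (t : ℕ) :
    ∑ j, |(((sortPart b c t)⁻¹ j : ℕ) : ℝ) - (j : ℕ)| ≤ 2 * countIn b (activeSet b) c t := by
  induction t with
  | zero => simp [sortPart, countIn]
  | succ t ih =>
    simp only [sortPart, countIn]
    split_ifs with h
    · have e : ∀ j, (sortPart b c t * adj (c t))⁻¹ j = adj (c t) ((sortPart b c t)⁻¹ j) :=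
        fun j => by rw [mul_inv_rev, Equiv.Perm.mul_apply, adj, Equiv.swap_inv]
      simp only [e]
      have h1 : ∀ j, |((adj (c t) ((sortPart b c t)⁻¹ j) : ℕ) : ℝ) - (j : ℕ)| ≤
          |(((sortPart b c t)⁻¹ j : ℕ) : ℝ) - (j : ℕ)| +
            if (sortPart b c t)⁻¹ j = lo (c t) ∨ (sortPart b c t)⁻¹ j = hi (c t) then 1 else 0 :=
        fun j => by
          have := abs_adj_sub_le (c t) ((sortPart b c t)⁻¹ j)
          refine (abs_sub_le _ (((sortPart b c t)⁻¹ j : ℕ) : ℝ) _).trans ?_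
          linarith
      have h2 := Finset.sum_le_sum fun j (_ : j ∈ Finset.univ) => h1 j
      rw [Finset.sum_add_distrib, Finset.sum_boole] at h2
      have h3 : ((Finset.univ.filter fun j : Fin n => (sortPart b c t)⁻¹ j = lo (c t) ∨
          (sortPart b c t)⁻¹ j = hi (c t)).card : ℝ) ≤ 2 := by
        exact_mod_cast card_touched_le _ _
      push_cast
      linarith
    · simpa using ih

theorem dev_one_eq (π : Equiv.Perm (Fin n)) :
    (dev π 1 : ℝ) = ∑ i, |((π i : ℕ) : ℝ) - (i : ℕ)| := by
  simp [dev, Nat.cast_natAbs]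

theorem le_mdev_one (π : Equiv.Perm (Fin n)) (i : Fin n) :
    |((π i : ℕ) : ℝ) - (i : ℕ)| ≤ mdev π 1 := by
  have h : ((π i : ℤ) - ((1 : Equiv.Perm (Fin n)) i : ℤ)).natAbs ≤ mdev π 1 :=
    Finset.le_sup (f := fun i => ((π i : ℤ) - ((1 : Equiv.Perm (Fin n)) i : ℤ)).natAbs)
      (Finset.mem_univ i)
  have h' := (Nat.cast_le (α := ℝ)).2 h
  simpa [Nat.cast_natAbs] using h'

/-- Evaluated at the current position S⁻¹ j of chip j, the permutation M·S takes the value M j; the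
triangle inequality does the rest. -/
theorem le_mdev_process (b : ℕ) (c : ℕ → Fin (n - 1)) (t : ℕ) (j : Fin n) :
    |((mixPart b c t j : ℕ) : ℝ) - (j : ℕ)| - countIn b (touchSet b j) c t ≤
      mdev (process b c t) 1 := by
  have h := le_mdev_one (process b c t) ((sortPart b c t)⁻¹ j)
  simp only [process_eq b c t, ← Equiv.Perm.mul_apply, mul_inv_cancel_right] at h ⊢
  have h1 := abs_sortPart_inv_sub_le b c j t
  have h2 := abs_sub_le ((mixPart b c t j : ℕ) : ℝ) (((sortPart b c t)⁻¹ j : ℕ) : ℝ) (j : ℕ)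
  linarith

theorem le_dev_process (b : ℕ) (c : ℕ → Fin (n - 1)) (t : ℕ) :
    ∑ j, |((mixPart b c t j : ℕ) : ℝ) - (j : ℕ)| - 2 * countIn b (activeSet b) c t ≤
      dev (process b c t) 1 := by
  rw [dev_one_eq, ← Equiv.sum_comp (sortPart b c t)⁻¹ fun i =>
    |((process b c t i : ℕ) : ℝ) - (i : ℕ)|]
  simp only [process_eq b c t, ← Equiv.Perm.mul_apply, mul_inv_cancel_right]
  have h1 := sum_abs_sortPart_inv_sub_le b c t
  have h2 : ∑ j, |((mixPart b c t j : ℕ) : ℝ) - (j : ℕ)| ≤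
      ∑ j, (|((mixPart b c t j : ℕ) : ℝ) - (((sortPart b c t)⁻¹ j : ℕ) : ℝ)| +
        |(((sortPart b c t)⁻¹ j : ℕ) : ℝ) - (j : ℕ)|) :=
    Finset.sum_le_sum fun j _ => abs_sub_le _ _ _
  rw [Finset.sum_add_distrib] at h2
  linarith

theorem card_support_process_le (b : ℕ) (c : ℕ → Fin (n - 1)) (t : ℕ) :
    (process b c t).support.card ≤ 2 * t := by
  have hadj : ∀ x : Fin (n - 1), (Equiv.swap (lo x) (hi x)).support.card ≤ 2 := fun x =>
    (Equiv.Perm.card_support_swap (by simp [lo, hi])).le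
  have hmul : ∀ σ τ : Equiv.Perm (Fin n), (σ * τ).support.card ≤ σ.support.card + τ.support.card :=
    fun σ τ => (Finset.card_le_card (Equiv.Perm.support_mul_le σ τ)).trans (Finset.card_union_le _ _)
  induction t with
  | zero => simp [process]
  | succ t ih =>
    simp only [process, sortingStep, mixingStep, swapAt]
    have h := hadj (c t)
    split_ifs
    · have := hmul (process b c t) (Equiv.swap (lo (c t)) (hi (c t)))
      omega
    · omega
    · rw [Equiv.Perm.support_inv]
      have := hmul (process b c t)⁻¹ (Equiv.swap (lo (c t)) (hi (c t)))
      rw [Equiv.Perm.support_inv] at this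
      omega

/-- A pair out of order contains a point that is not fixed; each step adds at most two such points,
and each lies in at most two pairs. -/
theorem card_activeSet_le (b : ℕ) (c : ℕ → Fin (n - 1)) (t : ℕ) :
    (activeSet b c t).card ≤ 4 * t := by
  have hsub : activeSet b c t ⊆ (Finset.univ.filter fun x => lo x ∈ (process b c t).support) ∪
      Finset.univ.filter fun x => hi x ∈ (process b c t).support := by
    intro x hx
    simp only [activeSet, Finset.mem_filter, Finset.mem_univ, true_and, Finset.mem_union,
      Equiv.Perm.mem_support] at hx ⊢
    by_contra! h
    rw [h.1, h.2] at hx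
    simp [lo, hi, Fin.lt_def] at hx
  have h1 : (Finset.univ.filter fun x : Fin (n - 1) => lo x ∈ (process b c t).support).card ≤
      (process b c t).support.card :=
    Finset.card_le_card_of_injOn lo (fun x hx => by simpa using hx) lo_injective.injOn
  have h2 : (Finset.univ.filter fun x : Fin (n - 1) => hi x ∈ (process b c t).support).card ≤
      (process b c t).support.card :=
    Finset.card_le_card_of_injOn hi (fun x hx => by simpa using hx) hi_injective.injOn
  have h3 := (Finset.card_le_card hsub).trans (Finset.card_union_le _ _)
  have h4 := card_support_process_le b c t
  omega

/-- Letters of sorting steps average out, and each letter of a mixing step contributes one `permOp`.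
-/
theorem wordMean_mixPart (x₀ : Fin (n - 1)) (b m : ℕ) (g : Equiv.Perm (Fin n) → ℝ) :
    wordMean x₀ m (fun c => g (mixPart b c m)) = permOp^[numMix b m] g 1 := by
  have : Nonempty (Fin (n - 1)) := ⟨x₀⟩
  induction m generalizing g with
  | zero => simp [wordMean_zero, mixPart, numMix]
  | succ m ih =>
    rw [wordMean_succ]
    simp only [mixPart, numMix, Function.update_self, mixPart_congr b (update_of_lt _ m _)]
    split_ifs with h
    · simp only [mean_const]
      exact ih g
    · rw [Function.iterate_succ_apply]
      exact ih (permOp g)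

/-- An exponential moment bound for counters in the sorting steps, weighted by a nonnegative
function of the mixing steps. -/
theorem wordMean_exp_countIn_le (x₀ : Fin (n - 1)) (b m : ℕ)
    {A : (ℕ → Fin (n - 1)) → ℕ → Finset (Fin (n - 1))}
    (hA : ∀ (c c' : ℕ → Fin (n - 1)) (t : ℕ), (∀ s < t, c s = c' s) → A c t = A c' t)
    {p s : ℝ} (hs : 0 ≤ s)
    (hp : ∀ c, ∀ t < m, ((A c t).card : ℝ) ≤ p * Fintype.card (Fin (n - 1)))
    {g : Equiv.Perm (Fin n) → ℝ} (hg : ∀ π, 0 ≤ g π) :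
    wordMean x₀ m (fun c => g (mixPart b c m) * Real.exp (s * countIn b A c m)) ≤
      Real.exp (p * (Real.exp s - 1) * numSorts b m) * permOp^[numMix b m] g 1 := by
  have : Nonempty (Fin (n - 1)) := ⟨x₀⟩
  induction m generalizing g with
  | zero => simp [wordMean_zero, mixPart, numMix, numSorts, countIn]
  | succ m ih =>
    rw [wordMean_succ]
    simp only [mixPart, numMix, numSorts, countIn, Function.update_self,
      mixPart_congr b (update_of_lt _ m _), countIn_congr b hA (update_of_lt _ m _),
      hA _ _ m (update_of_lt _ m _)]
    have hp' : ∀ c, ∀ t < m, ((A c t).card : ℝ) ≤ p * Fintype.card (Fin (n - 1)) :=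
      fun c t ht => hp c t (by omega)
    split_ifs with h
    · have h1 : ∀ c : ℕ → Fin (n - 1), mean (fun x => g (mixPart b c m) * Real.exp
          (s * ((countIn b A c m + if m % (b + 1) = 0 ∧ x ∈ A c m then 1 else 0 : ℕ) : ℝ))) ≤
          Real.exp (p * (Real.exp s - 1)) *
            (g (mixPart b c m) * Real.exp (s * countIn b A c m)) := fun c => by
        -- An indicator in the exponent is linear: exp(s·1) = 1 + (exp s − 1)·1. Its mean is at most
        -- 1 + p(exp s − 1) whatever the history, so no independence of the counter from the mixing
        -- part is needed.
        have e : ∀ x, g (mixPart b c m) * Real.exp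
          (s * ((countIn b A c m + if m % (b + 1) = 0 ∧ x ∈ A c m then 1 else 0 : ℕ) : ℝ)) =
          g (mixPart b c m) * Real.exp (s * countIn b A c m) *
            (1 + (Real.exp s - 1) * if x ∈ A c m then 1 else 0) := fun x => by
          simp only [h, true_and]
          split_ifs
          · push_cast
            rw [mul_add, Real.exp_add]
            ring_nf
          · simp
        simp only [e]
        rw [mean_const_mul, mul_comm]
        have h0 : 0 ≤ g (mixPart b c m) * Real.exp (s * countIn b A c m) :=
          mul_nonneg (hg _) (Real.exp_nonneg _)
        refine mul_le_mul_of_nonneg_right ?_ h0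
        rw [mean_add, mean_const, mean_const_mul]
        have hcard : mean (fun x => if x ∈ A c m then (1 : ℝ) else 0) ≤ p := by
          rw [mean, div_le_iff₀ (by exact_mod_cast Fintype.card_pos)]
          simpa using hp c m (by omega)
        have := Real.add_one_le_exp (p * (Real.exp s - 1))
        have hs1 : 0 ≤ Real.exp s - 1 := by linarith [Real.add_one_le_exp s]
        nlinarith
      refine (wordMean_mono x₀ m h1).trans ?_
      rw [wordMean_const_mul]
      push_cast
      rw [mul_add, mul_one, Real.exp_add, mul_comm (Real.exp (_ * (numSorts b m : ℝ))), mul_assoc]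
      exact mul_le_mul_of_nonneg_left (ih hp' hg) (Real.exp_nonneg _)
    · have e : ∀ (c : ℕ → Fin (n - 1)), mean (fun x => g (adj x * mixPart b c m) * Real.exp
          (s * ((countIn b A c m + if m % (b + 1) = 0 ∧ x ∈ A c m then 1 else 0 : ℕ) : ℝ))) =
          permOp g (mixPart b c m) * Real.exp (s * countIn b A c m) := fun c => by
        simp only [h, false_and, if_false, add_zero]
        exact mean_mul_const _ _
      simp only [e]
      rw [Function.iterate_succ_apply]
      exact ih hp' fun π => mean_nonneg fun x => hg _

end Parts

/-! ### Displacement of a single value -/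

section Chip

variable {n : ℕ}

/-- A lower bound for the mean absolute displacement after `k` steps, with a free scale `B`. -/
theorem le_chipOp_iterate_abs (hn : 3 ≤ n) (k : ℕ) {B v : ℝ} (hB : 0 < B)
    (hv : v = k * (2 / ((n : ℝ) - 1))) (hvB : v ≤ B ^ 2) (j : Fin n)
    (hj : B ≤ (j : ℕ)) (hj' : (j : ℕ) + B ≤ (n : ℝ) - 1) :
    4 / B * v - 256 / 27 / B ^ 3 * (v + 3 * v ^ 2) ≤
      chipOp^[k] (fun v : Fin n => |(((v : ℤ) - (j : ℕ) : ℤ) : ℝ)|) j := by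
  have hn' : (0 : ℝ) < (n : ℝ) - 1 := by
    have : (3 : ℝ) ≤ n := by exact_mod_cast hn
    linarith
  set q : ℝ := 2 / ((n : ℝ) - 1) with hq
  have hq0 : 0 < q := by positivity
  have hdiv : ∀ x : ℝ, x / ((n : ℝ) - 1) = x * (q / 2) := fun x => by rw [hq]; field_simp
  -- The bracketed polynomials are the second and fourth moments of the walk on the integers started
  -- at d after s steps, where q is the variance of one step. Hence u solves the heat equation
  -- exactly.
  let u : ℕ → ℤ → ℝ := fun s d => 4 / B * ((d : ℝ) ^ 2 + q * s) -
    256 / 27 / B ^ 3 * ((d : ℝ) ^ 4 + 6 * q * s * (d : ℝ) ^ 2 + q * s + 3 * q ^ 2 * s * (s - 1))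
  have key := le_chipOp_iterate hn B k u ?_ ?_ (fun d => |(d : ℝ)|) (fun d => abs_nonneg _) ?_ j hj
    hj'
  · refine le_trans ?_ key
    have e : u k 0 = 4 / B * v - 256 / 27 / B ^ 3 * (v + 3 * v ^ 2 - 3 * q * v) := by
      simp only [u, hv]; push_cast; ring
    rw [e]
    have hv0 : 0 ≤ v := by rw [hv]; positivity
    gcongr
    have : 0 ≤ 3 * q * v := by positivity
    linarith
  · intro s _ d
    rw [hdiv]
    apply le_of_eq
    simp only [u]
    push_cast
    ring
  · intro s hs d hd
    have hx : 1 ≤ |(d : ℝ)| / B := by rwa [le_div_iff₀ hB, one_mul]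
    set x := |(d : ℝ)| / B with hxd
    have hd2 : (d : ℝ) ^ 2 = B ^ 2 * x ^ 2 := by
      rw [hxd, div_pow, sq_abs]; field_simp
    have hd4 : (d : ℝ) ^ 4 = B ^ 4 * x ^ 4 := by
      rw [show (d : ℝ) ^ 4 = ((d : ℝ) ^ 2) ^ 2 by ring, hd2]; ring
    have hqs : q * s ≤ B ^ 2 := by
      refine le_trans ?_ hvB
      rw [hv, mul_comm]
      gcongr
    have hs1 : 0 ≤ 6 * q * s * (d : ℝ) ^ 2 + q * s + 3 * q ^ 2 * s * (s - 1) := by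
      rcases Nat.eq_zero_or_pos s with rfl | h
      · simp
      · have : (1 : ℝ) ≤ s := by exact_mod_cast h
        have : 0 ≤ (s : ℝ) - 1 := by linarith
        positivity
    have h1 : 256 / 27 / B ^ 3 * (d : ℝ) ^ 4 ≤ 256 / 27 / B ^ 3 *
        ((d : ℝ) ^ 4 + 6 * q * s * (d : ℝ) ^ 2 + q * s + 3 * q ^ 2 * s * (s - 1)) := by
      gcongr
      linarith
    have h2 : 4 / B * ((d : ℝ) ^ 2 + q * s) ≤ 4 / B * ((d : ℝ) ^ 2 + B ^ 2) := by gcongr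
    have h3 : 4 / B * ((d : ℝ) ^ 2 + B ^ 2) - 256 / 27 / B ^ 3 * (d : ℝ) ^ 4 =
        B * (4 * x ^ 2 + 4 - 256 / 27 * x ^ 4) := by
      rw [hd2, hd4]; field_simp
    have h4 : 4 * x ^ 2 + 4 - 256 / 27 * x ^ 4 ≤ 0 := by
      have : 1 ≤ x ^ 2 := one_le_pow₀ hx
      nlinarith
    have h5 := mul_nonpos_of_nonneg_of_nonpos hB.le h4
    simp only [u]
    linarith
  · intro d
    set x := |(d : ℝ)| / B with hxd
    have hx : 0 ≤ x := by positivity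
    have hd1 : |(d : ℝ)| = B * x := by rw [hxd]; field_simp
    have hd2 : (d : ℝ) ^ 2 = B ^ 2 * x ^ 2 := by rw [← sq_abs, hd1]; ring
    have e : u 0 d = B * (4 * x ^ 2 - 256 / 27 * x ^ 4) := by
      simp only [u]
      rw [show (d : ℝ) ^ 4 = ((d : ℝ) ^ 2) ^ 2 by ring, hd2]
      push_cast
      field_simp
      ring
    rw [e, hd1]
    gcongr
    -- This product equals x − 4x² + (256/27)x⁴: the coefficient 256/27 makes the quartic tangent to
    -- x at x = 3/8.
    have : 0 ≤ x * ((1 - 8 * x / 3) ^ 2 * (1 + 4 * x / 3)) := by positivity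
    nlinarith

/-- A lower bound for the probability of a large displacement after `k` steps. -/
theorem le_chipOp_iterate_tail (hn : 3 ≤ n) (k : ℕ) {l q A₁ A₂ X W : ℝ} (hl : 0 ≤ l)
    (hq : q = 2 / ((n : ℝ) - 1)) (hA₁ : A₁ = (1 + q * (Real.cosh l - 1)) ^ k)
    (hA₂ : A₂ = (1 + q * (Real.cosh (2 * l) - 1)) ^ k) (hX : Real.exp (l * X) ≤ A₁ / 4)
    (hW : 8 * A₂ ≤ Real.exp (l * W)) (j : Fin n)
    (hj : W ≤ (j : ℕ)) (hj' : (j : ℕ) + W ≤ (n : ℝ) - 1) :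
    A₁ ^ 2 / (2 * A₂) ≤ chipOp^[k]
      (fun v : Fin n => if X ≤ |(((v : ℤ) - (j : ℕ) : ℤ) : ℝ)| then 1 else 0) j := by
  have hn2 : (2 : ℝ) ≤ (n : ℝ) - 1 := by
    have : (3 : ℝ) ≤ n := by exact_mod_cast hn
    linarith
  have hn' : (0 : ℝ) < (n : ℝ) - 1 := by linarith
  have hq0 : 0 < q := by rw [hq]; positivity
  have hq1 : q ≤ 1 := by rw [hq, div_le_one hn']; exact hn2
  have hdiv : ∀ x : ℝ, x / ((n : ℝ) - 1) = x * (q / 2) := fun x => by rw [hq]; field_simp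
  have hcosh2 : ∀ y : ℝ, Real.cosh (2 * y) = 2 * Real.cosh y ^ 2 - 1 := fun y => by
    rw [Real.cosh_two_mul, Real.sinh_sq]; ring
  have hc := Real.one_le_cosh l
  set r₁ := 1 + q * (Real.cosh l - 1) with hr₁
  set r₂ := 1 + q * (Real.cosh (2 * l) - 1) with hr₂
  have hr₁1 : 1 ≤ r₁ := by
    have : 0 ≤ q * (Real.cosh l - 1) := mul_nonneg hq0.le (by linarith)
    linarith
  have hr12 : r₁ ^ 2 ≤ r₂ := by
    rw [hr₁, hr₂, hcosh2]
    have h1 : 0 ≤ Real.cosh l - 1 := by linarith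
    have h2 : 0 ≤ q * (Real.cosh l - 1) * (2 * Real.cosh l - q * (Real.cosh l - 1)) :=
      mul_nonneg (mul_nonneg hq0.le h1) (by nlinarith)
    nlinarith
  have hr12' : r₁ ≤ r₂ := le_trans (by nlinarith) hr12
  have hr₂1 : 1 ≤ r₂ := hr₁1.trans hr12'
  have hA₁1 : 1 ≤ A₁ := by rw [hA₁]; exact one_le_pow₀ hr₁1
  have hA12 : A₁ ^ 2 ≤ A₂ := by
    rw [hA₁, hA₂, ← pow_mul, mul_comm, pow_mul]
    exact pow_le_pow_left₀ (by positivity) hr12 k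
  have hA₂1 : 1 ≤ A₂ := by nlinarith
  -- A Paley–Zygmund argument. With Z = cosh(l·d), the indicator is bounded below by −C(Z − θ)(Z −
  -- M), which is positive only for θ < Z < M and at most 1 by the choice C = 4 / M². Since Z² =
  -- (cosh(2l·d) + 1)/2, its expectation is explicit in A₁ and A₂, the means of cosh(l·d) and
  -- cosh(2l·d) for the walk from 0; M is chosen with M·A₁ = 2A₂.
  set θ := A₁ / 4 with hθ
  set M := 2 * A₂ / A₁ with hM
  have hA₁0 : 0 < A₁ := by linarith
  have hA₂0 : 0 < A₂ := by linarith
  have hMθ : θ ≤ M := by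
    rw [hM, le_div_iff₀ hA₁0, hθ]; nlinarith
  have hM0 : 0 < M := by positivity
  have hMA : M ≤ 2 * A₂ := div_le_self (by positivity) hA₁1
  set C := 4 / M ^ 2 with hC
  have hC0 : 0 < C := by positivity
  have hθ0 : 0 < θ := by positivity
  let u : ℕ → ℤ → ℝ := fun s d => C * ((θ + M) * r₁ ^ s * Real.cosh (l * d) -
    r₂ ^ s * Real.cosh (2 * (l * d)) / 2 - 1 / 2 - θ * M)
  have habs : ∀ d : ℤ, Real.cosh (l * d) = Real.cosh (l * |(d : ℝ)|) := fun d => by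
    rw [← Real.cosh_abs, abs_mul, abs_of_nonneg hl]
  have key := le_chipOp_iterate hn W k u ?_ ?_ (fun d => if X ≤ |(d : ℝ)| then 1 else 0)
    (fun d => by split_ifs <;> norm_num) ?_ j hj hj'
  · refine le_trans ?_ key
    have e : u k 0 = C * (A₁ ^ 2 / 4 + A₂ - 1 / 2) := by
      simp only [u, ← hA₁, ← hA₂]
      have : M * A₁ = 2 * A₂ := by rw [hM]; field_simp
      have h2 : θ * M = A₂ / 2 := by rw [hθ, hM]; field_simp; norm_num
      simp only [Int.cast_zero, mul_zero, Real.cosh_zero, mul_one, h2]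
      rw [add_mul, this, hθ]
      ring
    have e2 : A₁ ^ 2 / (2 * A₂) = C * (A₂ / 2) := by
      rw [hC, hM]; field_simp; norm_num
    rw [e, e2]
    gcongr
    nlinarith
  · intro s _ d
    rw [hdiv]
    apply le_of_eq
    have h1 : Real.cosh (l * (d + 1)) + Real.cosh (l * (d - 1)) =
        2 * Real.cosh (l * d) * Real.cosh l := by
      rw [mul_add, mul_sub, mul_one, Real.cosh_add, Real.cosh_sub]; ring
    have h2 : Real.cosh (2 * (l * (d + 1))) + Real.cosh (2 * (l * (d - 1))) =
        2 * Real.cosh (2 * (l * d)) * Real.cosh (2 * l) := by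
      rw [mul_add, mul_sub, mul_one, mul_add, mul_sub, Real.cosh_add, Real.cosh_sub]; ring
    have e : u s (d + 1) + u s (d - 1) - 2 * u s d = C * ((θ + M) * r₁ ^ s *
        (Real.cosh (l * (d + 1)) + Real.cosh (l * (d - 1)) - 2 * Real.cosh (l * d)) -
        r₂ ^ s * (Real.cosh (2 * (l * (d + 1))) + Real.cosh (2 * (l * (d - 1))) -
          2 * Real.cosh (2 * (l * d))) / 2) := by
      simp only [u]
      push_cast
      ring
    rw [e, h1, h2]
    simp only [u, pow_succ]
    nth_rewrite 1 [hr₁]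
    nth_rewrite 2 [hr₂]
    ring
  · intro s _ d hd
    have hZ : θ + M + 1 ≤ Real.cosh (l * d) := by
      rw [habs, Real.cosh_eq]
      have h1 : Real.exp (l * W) ≤ Real.exp (l * |(d : ℝ)|) := by gcongr
      have h2 := Real.exp_pos (-(l * |(d : ℝ)|))
      have h3 : θ ≤ A₂ / 4 := by rw [hθ]; nlinarith
      linarith
    have hZ1 := Real.one_le_cosh (l * d)
    have hrs : r₁ ^ s ≤ r₂ ^ s := pow_le_pow_left₀ (by linarith) hr12' s
    have hrs0 : 0 < r₂ ^ s := by positivity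
    simp only [u]
    rw [hcosh2]
    refine mul_nonpos_of_nonneg_of_nonpos hC0.le ?_
    have h1 : (θ + M) * r₁ ^ s * Real.cosh (l * d) ≤
        (Real.cosh (l * d) - 1) * r₂ ^ s * Real.cosh (l * d) := by
      gcongr
      linarith
    have h2 : 0 ≤ r₂ ^ s * (Real.cosh (l * d) - 1 / 2) := mul_nonneg hrs0.le (by linarith)
    have h3 : 0 ≤ θ * M := by positivity
    have h4 : (Real.cosh (l * d) - 1) * r₂ ^ s * Real.cosh (l * d) -
        r₂ ^ s * (2 * Real.cosh (l * d) ^ 2 - 1) / 2 = -(r₂ ^ s * (Real.cosh (l * d) - 1 / 2)) := by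
      ring
    linarith
  · intro d
    have e : u 0 d = -(C * ((Real.cosh (l * d) - θ) * (Real.cosh (l * d) - M))) := by
      simp only [u, pow_zero]
      rw [hcosh2]
      ring
    rw [e]
    split_ifs with h
    · have h1 : -((Real.cosh (l * d) - θ) * (Real.cosh (l * d) - M)) ≤ M ^ 2 / 4 := by
        have h2 := sq_nonneg (Real.cosh (l * d) - (θ + M) / 2)
        have h3 : 0 ≤ θ * (2 * M - θ) := mul_nonneg hθ0.le (by linarith)
        linarith
      have h2 : C * (M ^ 2 / 4) = 1 := by rw [hC]; field_simp
      have h3 := mul_le_mul_of_nonneg_left h1 hC0.le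
      rw [mul_neg, h2] at h3
      exact h3
    · have hZ : Real.cosh (l * d) ≤ θ := by
        refine le_trans ?_ hX
        rw [habs, Real.cosh_eq]
        have h1 : Real.exp (l * |(d : ℝ)|) ≤ Real.exp (l * X) := by
          gcongr
          exact (not_le.1 h).le
        have h2 : Real.exp (-(l * |(d : ℝ)|)) ≤ Real.exp (l * |(d : ℝ)|) := by
          gcongr
          have := mul_nonneg hl (abs_nonneg (d : ℝ))
          linarith
        linarith
      have : 0 ≤ C * ((θ - Real.cosh (l * d)) * (M - Real.cosh (l * d))) :=
        mul_nonneg hC0.le (mul_nonneg (by linarith) (by linarith))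
      rw [← neg_nonneg, neg_neg]
      convert this using 2
      ring

end Chip

/-! ### Numerical estimates -/

section Numerics

theorem one_add_sq_div_two_le_cosh (x : ℝ) : 1 + x ^ 2 / 2 ≤ Real.cosh x := by
  have h : Real.cosh x = 1 + 2 * Real.sinh (x / 2) ^ 2 := by
    have := Real.cosh_two_mul (x / 2)
    rw [Real.cosh_sq, show 2 * (x / 2) = x by ring] at this
    linarith
  have h2 : (x / 2) ^ 2 ≤ Real.sinh (x / 2) ^ 2 := by
    rw [sq_le_sq, Real.abs_sinh]
    exact Real.self_le_sinh_iff.2 (abs_nonneg _)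
  rw [h]
  linarith

theorem cosh_eq_two_mul_sq_half (x : ℝ) : Real.cosh x = 2 * Real.cosh (x / 2) ^ 2 - 1 := by
  have := Real.cosh_two_mul (x / 2)
  rw [Real.sinh_sq, show 2 * (x / 2) = x by ring] at this
  linarith

/-- Two doublings of the quadratic bound at x/4. The quartic term matters for b = 1, where the
quadratic one alone would give too small an exponent. -/
theorem le_cosh_sub_one (x : ℝ) : x ^ 2 / 2 + 5 / 128 * x ^ 4 ≤ Real.cosh x - 1 := by
  have h1 := one_add_sq_div_two_le_cosh (x / 2 / 2)
  have h2 : 1 + x ^ 2 / 8 + x ^ 4 / 512 ≤ Real.cosh (x / 2) := by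
    rw [cosh_eq_two_mul_sq_half (x / 2)]
    have := pow_le_pow_left₀ (by positivity) h1 2
    nlinarith
  rw [cosh_eq_two_mul_sq_half x]
  have h3 := pow_le_pow_left₀ (by positivity) h2 2
  have h4 : 0 ≤ x ^ 6 := by positivity
  have h5 : 0 ≤ x ^ 8 := by positivity
  nlinarith

theorem cosh_le_of_abs_le_one {x : ℝ} (hx : |x| ≤ 1) :
    Real.cosh x ≤ 1 + x ^ 2 / 2 + 5 / 96 * x ^ 4 := by
  -- Averaging the expansions at x and −x cancels the odd terms; 5/96 = 5/(4!·4) is the remainder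
  -- constant of `Real.exp_bound`.
  have h1 := (abs_le.1 (Real.exp_bound hx (n := 4) (by norm_num))).2
  have h2 := (abs_le.1 (Real.exp_bound (x := -x) (by rwa [abs_neg]) (n := 4) (by norm_num))).2
  rw [abs_neg] at h2
  have h3 : |x| ^ 4 = x ^ 4 := by rw [show 4 = 2 * 2 by norm_num, pow_mul, sq_abs, pow_mul]
  rw [h3] at h1 h2
  norm_num [Finset.sum_range_succ, Nat.factorial] at h1 h2
  rw [Real.cosh_eq]
  nlinarith

/-- Constants for the tail parameter l = 4/B. With v ≈ bBL/50 the exponent v·a must exceed 0.101·L,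
and the loss 2va(a + 1 + qa) must stay below 0.9·L; here qa ≤ 0.001, whence the 1.001. -/
theorem cosh_four_div_bounds {b : ℕ} (hb : 1 ≤ b) {B a : ℝ} (hB : B = (b : ℝ) + 1)
    (ha : a = Real.cosh (4 / B) - 1) :
    5.2 ≤ b * B * a ∧ b * B * a ≤ 9.35 ∧ a ≤ 2.82 ∧ b * B * a * (a + 1.001) ≤ 22.4 := by
  have hb' : (b : ℝ) = B - 1 := by linarith
  have hb1 : (1 : ℝ) ≤ b := by exact_mod_cast hb
  have hB2 : 2 ≤ B := by linarith
  have hB0 : 0 < B := by linarith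
  have hlow : 8 / B ^ 2 + 10 / B ^ 4 ≤ a := by
    rw [ha]
    refine le_trans (le_of_eq ?_) (le_cosh_sub_one (4 / B))
    field_simp
    ring
  have h1 : 5.2 ≤ b * B * a := by
    have h2 : (b : ℝ) * B * (8 / B ^ 2 + 10 / B ^ 4) ≤ b * B * a := by gcongr
    refine le_trans ?_ h2
    rw [hb', show (B - 1) * B * (8 / B ^ 2 + 10 / B ^ 4) = (B - 1) * (8 * B ^ 2 + 10) / B ^ 3 by
      field_simp, le_div_iff₀ (by positivity)]
    nlinarith [mul_nonneg (sub_nonneg.2 hB2) (sq_nonneg (B - 2)), sq_nonneg (B - 2)]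
  have hup : ∀ w : ℝ, w = 1 / B ^ 2 →
      a ≤ 2 * w * (2 + 5 / 6 * w) * (2 + 2 * w + 5 / 6 * w ^ 2) := fun w hw => by
    have hy : |2 / B| ≤ 1 := by
      rw [abs_of_pos (by positivity), div_le_one hB0]; exact hB2
    have h2 := cosh_le_of_abs_le_one hy
    have h3 := pow_le_pow_left₀ (Real.cosh_pos _).le h2 2
    have h4 : (2 / B) ^ 2 = 4 * w := by rw [hw]; field_simp; norm_num
    have h5 : (2 / B) ^ 4 = 16 * w ^ 2 := by
      rw [show (2 / B) ^ 4 = ((2 / B) ^ 2) ^ 2 by ring, h4]; ring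
    rw [h4, h5] at h3
    rw [ha, cosh_eq_two_mul_sq_half, show 4 / B / 2 = 2 / B by ring]
    nlinarith
  have ha0 : 0 ≤ a := by rw [ha]; linarith [Real.one_le_cosh (4 / B)]
  rcases Nat.lt_or_ge b 2 with h | h
  · have hb1' : b = 1 := by omega
    have hB2' : B = 2 := by rw [hB, hb1']; norm_num
    have h2 := hup (1 / 4) (by rw [hB2']; norm_num)
    have h3 : a ≤ 2.82 := h2.trans (by norm_num)
    refine ⟨h1, ?_, h3, ?_⟩ <;> rw [hb1', hB2'] <;> push_cast <;> nlinarith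
  · have hB3 : 3 ≤ B := by
      have : (2 : ℝ) ≤ b := by exact_mod_cast h
      linarith
    obtain ⟨w, hw⟩ : ∃ w, w = 1 / B ^ 2 := ⟨_, rfl⟩
    have hw0 : 0 ≤ w := by rw [hw]; positivity
    have hw1 : w ≤ 1 / 9 := by
      rw [hw]
      exact one_div_le_one_div_of_le (by norm_num) (by nlinarith)
    have h2 : a ≤ 9.35 * w := by
      refine (hup w hw).trans ?_
      have h3 : (2 + 5 / 6 * w) * (2 + 2 * w + 5 / 6 * w ^ 2) ≤
          (2 + 5 / 6 * (1 / 9)) * (2 + 2 * (1 / 9) + 5 / 6 * (1 / 9) ^ 2) := by gcongr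
      nlinarith
    have h4 : b * B * a ≤ 9.35 := by
      have h5 : (b : ℝ) * B * a ≤ b * B * (9.35 * w) := by gcongr
      have h6 : (b : ℝ) * B * (9.35 * w) = 9.35 * (1 - 1 / B) := by
        rw [hb', hw]; field_simp
      have : 0 < 1 / B := by positivity
      linarith
    have h5 : a ≤ 1.04 := by linarith
    refine ⟨h1, h4, by linarith, ?_⟩
    have h6 : 0 ≤ b * B * a := by positivity
    nlinarith

/-- Uses x(1 − x) ≤ x/(1 + x) ≤ log(1 + x). -/
theorem exp_mul_le_one_add_pow {x : ℝ} (hx : 0 ≤ x) (k : ℕ) :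
    Real.exp (k * (x * (1 - x))) ≤ (1 + x) ^ k := by
  rw [Real.exp_nat_mul]
  refine pow_le_pow_left₀ (Real.exp_nonneg _) ?_ k
  have h1 : x * (1 - x) ≤ x / (1 + x) := by
    rw [le_div_iff₀ (by linarith)]
    nlinarith [pow_nonneg hx 3]
  refine (Real.exp_le_exp.2 h1).trans ?_
  have h2 := Real.add_one_le_exp (-(x / (1 + x)))
  have h3 : -(x / (1 + x)) + 1 = (1 + x)⁻¹ := by field_simp; ring
  rw [h3, Real.exp_neg] at h2
  exact (inv_le_inv₀ (by linarith) (Real.exp_pos _)).1 h2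

theorem one_add_pow_le_exp {x : ℝ} (hx : 0 ≤ x) (k : ℕ) :
    (1 + x) ^ k ≤ Real.exp (k * x) := by
  rw [Real.exp_nat_mul]
  refine pow_le_pow_left₀ (by linarith) ?_ k
  linarith [Real.add_one_le_exp x]

/-- The numbers of sorting and mixing steps up to time `B² Y / 100`. -/
theorem numSorts_numMix_bounds {b : ℕ} {B Y : ℝ} (hB : B = (b : ℝ) + 1) (hY : 0 ≤ Y) {m : ℕ}
    (hm : m = ⌊1 / 100 * B ^ 2 * Y⌋₊) :
    (numSorts b m : ℝ) ≤ B * Y / 100 + 1 ∧ b * B * Y / 100 - 2 ≤ (numMix b m : ℝ) ∧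
      (numMix b m : ℝ) ≤ b * B * Y / 100 := by
  have hB0 : 0 < B := by rw [hB]; positivity
  have hm1 : (m : ℝ) ≤ 1 / 100 * B ^ 2 * Y := by rw [hm]; exact Nat.floor_le (by positivity)
  have hm2 : 1 / 100 * B ^ 2 * Y < m + 1 := by rw [hm]; exact Nat.lt_floor_add_one _
  have h1 : (m : ℝ) ≤ B * numSorts b m := by
    rw [hB]; exact_mod_cast (numSorts_bounds b m).1
  have h2 : B * numSorts b m ≤ m + b := by
    rw [hB]; exact_mod_cast (numSorts_bounds b m).2
  have h3 : (numSorts b m : ℝ) + numMix b m = m := by exact_mod_cast numSorts_add_numMix b m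
  have hk : (numMix b m : ℝ) = m - numSorts b m := by linarith
  have hb : (b : ℝ) = B - 1 := by linarith
  have hb0 : (0 : ℝ) ≤ B - 1 := by rw [← hb]; positivity
  rw [hk, hb]
  rw [hb] at h2
  refine ⟨?_, ?_, ?_⟩ <;> refine le_of_mul_le_mul_left ?_ hB0 <;> nlinarith

theorem card_interior_ge (n : ℕ) {W : ℝ} (hW : 0 ≤ W) :
    (n : ℝ) - 2 * W - 2 ≤ ((Finset.univ.filter fun j : Fin n =>
      W ≤ (j : ℕ) ∧ ((j : ℕ) : ℝ) + W ≤ (n : ℝ) - 1).card : ℝ) := by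
  set a := ⌈W⌉₊
  have ha : W ≤ a := Nat.le_ceil W
  have ha' : (a : ℝ) < W + 1 := Nat.ceil_lt_add_one hW
  have h : n - 2 * a ≤ (Finset.univ.filter fun j : Fin n =>
      W ≤ (j : ℕ) ∧ ((j : ℕ) : ℝ) + W ≤ (n : ℝ) - 1).card := by
    rw [← Finset.card_range (n - 2 * a), ← Finset.card_attach]
    refine Finset.card_le_card_of_injOn
      (fun i => ⟨i.1 + a, by have := Finset.mem_range.1 i.2; omega⟩) (fun i _ => ?_) ?_
    · have hi := Finset.mem_range.1 i.2
      simp only [Finset.coe_filter, Finset.mem_univ, true_and, Set.mem_ofPred_eq]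
      have hi' : ((i.1 + a + a + 1 : ℕ) : ℝ) ≤ n := by exact_mod_cast (by omega)
      push_cast at hi' ⊢
      have : (0 : ℝ) ≤ (i.1 : ℕ) := Nat.cast_nonneg _
      constructor <;> linarith
    · intro i _ j _ hij
      simp only [Fin.mk.injEq] at hij
      exact Subtype.ext (by omega)
  generalize (Finset.univ.filter fun j : Fin n =>
    W ≤ (j : ℕ) ∧ ((j : ℕ) : ℝ) + W ≤ (n : ℝ) - 1).card = c at h ⊢
  have h' : (n : ℝ) ≤ 2 * a + c := by exact_mod_cast (by omega : n ≤ 2 * a + c)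
  linarith

end Numerics

/-! ### The maximum deviation -/

section MaxDeviation

variable {n b : ℕ}

/-- Bounds for the exponents that occur in the estimate of the tail of a displacement. -/
theorem tail_exponent_bounds {e a q v L N k : ℝ} (hN : 1000000 ≤ N) (hL : 1000 ≤ L) (he : 2 ≤ e)
    (ha0 : 0 ≤ a) (ha1 : 5.2 ≤ e * a) (ha2 : e * a ≤ 9.35) (ha3 : a ≤ 2.82)
    (ha4 : e * a * (a + 1.001) ≤ 22.4) (hq : q = 2 / (N - 1)) (hv : v = k * q)
    (hk1 : e * (N * L) / 100 - 2 ≤ k) (hk2 : k ≤ e * (N * L) / 100) :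
    0.1036 * L ≤ v * a * (1 - q * a) ∧ 2 * (v * a) * (a + 2) ≤ 2 * L ∧
      2 * (v * a) * (a + 2) ≤ 0.9 * L + 2 * (v * a * (1 - q * a)) := by
  have hN' : 0 < N - 1 := by linarith
  have hv' : v = 2 * k / (N - 1) := by rw [hv, hq]; ring
  have heL : 2000 ≤ e * L := by nlinarith
  have heLN : e * L * 1000000 ≤ e * L * N := mul_le_mul_of_nonneg_left hN (by linarith)
  have hv1 : 0.999 * (e * L / 50) ≤ v := by
    rw [hv', le_div_iff₀ hN']
    linarith
  have hv2 : v ≤ 1.001 * (e * L / 50) := by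
    rw [hv', div_le_iff₀ hN']
    linarith
  have hqa : q * a ≤ 0.001 := by
    rw [hq, div_mul_eq_mul_div, div_le_iff₀ hN']
    linarith
  have hv0 : 0 ≤ v := by linarith
  have hva0 : 0 ≤ v * a := by positivity
  have hvqa : v * a * (q * a) ≤ v * a * 0.001 := mul_le_mul_of_nonneg_left hqa hva0
  have hL0 : 0 ≤ L := by linarith
  have hva1 : 0.1038 * L ≤ v * a := by
    have h1 := mul_le_mul_of_nonneg_right hv1 ha0
    have h2 := mul_le_mul_of_nonneg_right ha1 hL0
    linarith
  have hva2 : v * a ≤ 0.1872 * L := by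
    have h1 := mul_le_mul_of_nonneg_right hv2 ha0
    have h2 := mul_le_mul_of_nonneg_right ha2 hL0
    linarith
  have hva3 : v * a * (a + 1.001) ≤ 0.449 * L := by
    have h1 := mul_le_mul_of_nonneg_right hv2 (mul_nonneg ha0 (by linarith : 0 ≤ a + 1.001))
    have h2 := mul_le_mul_of_nonneg_right ha4 hL0
    linarith
  have hva4 : v * a * a ≤ v * a * 2.82 := mul_le_mul_of_nonneg_left ha3 hva0
  refine ⟨by linarith, by linarith, by linarith⟩

theorem le_chipOp_iterate_numMix_tail (hb : 1 ≤ b) {B L : ℝ} (hB : B = (b : ℝ) + 1)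
    (hL : 1000 ≤ L) (hLn : L ≤ n / 1000) {m : ℕ} (hm : m = ⌊1 / 100 * B ^ 2 * (n * L)⌋₊)
    (j : Fin n) (hj : B * L ≤ (j : ℕ)) (hj' : (j : ℕ) + B * L ≤ (n : ℝ) - 1) :
    Real.exp (-(0.9 * L)) / 2 ≤ chipOp^[numMix b m] (fun v : Fin n =>
      if 101 / 4000 * (B * L) ≤ |(((v : ℤ) - (j : ℕ) : ℤ) : ℝ)| then 1 else 0) j := by
  have hn : (1000000 : ℝ) ≤ n := by linarith
  have hn3 : 3 ≤ n := by
    have : (3 : ℝ) ≤ n := by linarith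
    exact_mod_cast this
  have hn' : (0 : ℝ) < (n : ℝ) - 1 := by linarith
  have hb1 : (1 : ℝ) ≤ b := by exact_mod_cast hb
  have hB2 : 2 ≤ B := by linarith
  have hB0 : 0 < B := by linarith
  have hL0 : 0 < L := by linarith
  obtain ⟨-, hk1, hk2⟩ := numSorts_numMix_bounds hB (by positivity) hm
  obtain ⟨a, ha⟩ : ∃ a, a = Real.cosh (4 / B) - 1 := ⟨_, rfl⟩
  obtain ⟨ha1, ha2, ha3, ha4⟩ := cosh_four_div_bounds hb hB ha
  have ha0 : 0 ≤ a := by rw [ha]; linarith [Real.one_le_cosh (4 / B)]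
  obtain ⟨q, hq⟩ : ∃ q : ℝ, q = 2 / ((n : ℝ) - 1) := ⟨_, rfl⟩
  have hq0 : 0 < q := by rw [hq]; positivity
  have hqa0 : 0 ≤ q * a := by positivity
  generalize numMix b m = k at hk1 hk2 ⊢
  obtain ⟨v, hv⟩ : ∃ v, v = k * q := ⟨_, rfl⟩
  obtain ⟨he1, he2, he3⟩ := tail_exponent_bounds hn hL (by nlinarith : 2 ≤ (b : ℝ) * B) ha0 ha1 ha2
    ha3 ha4 hq hv hk1 hk2
  have hl : 0 ≤ 4 / B := by positivity
  have hA₁ : Real.exp (v * a * (1 - q * a)) ≤ (1 + q * (Real.cosh (4 / B) - 1)) ^ k := by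
    rw [← ha]
    refine le_trans (le_of_eq ?_) (exp_mul_le_one_add_pow hqa0 k)
    rw [hv]
    ring_nf
  have hc2 : Real.cosh (2 * (4 / B)) - 1 = 2 * a * (a + 2) := by
    rw [Real.cosh_two_mul, Real.sinh_sq, show Real.cosh (4 / B) = a + 1 by linarith]
    ring
  have hA₂ : (1 + q * (Real.cosh (2 * (4 / B)) - 1)) ^ k ≤ Real.exp (2 * (v * a) * (a + 2)) := by
    rw [hc2]
    refine (one_add_pow_le_exp (by positivity) k).trans (le_of_eq ?_)
    rw [hv]
    ring_nf
  have hexp2 : ∀ y : ℝ, 2 ≤ y → 4 ≤ Real.exp y := fun y hy => by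
    have h1 := Real.add_one_le_exp (y / 2)
    have h2 : Real.exp y = Real.exp (y / 2) * Real.exp (y / 2) := by
      rw [← Real.exp_add]; ring_nf
    rw [h2]
    nlinarith
  refine le_trans ?_ (le_chipOp_iterate_tail hn3 k (X := 101 / 4000 * (B * L)) (W := B * L) hl hq
    rfl rfl ?_ ?_ j hj hj')
  · have hpos : 0 < (1 + q * (Real.cosh (2 * (4 / B)) - 1)) ^ k := by
      rw [hc2]; positivity
    rw [div_le_div_iff₀ (by norm_num) (by positivity)]
    have h1 : Real.exp (-(0.9 * L)) * (1 + q * (Real.cosh (2 * (4 / B)) - 1)) ^ k ≤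
        ((1 + q * (Real.cosh (4 / B) - 1)) ^ k) ^ 2 := by
      calc Real.exp (-(0.9 * L)) * (1 + q * (Real.cosh (2 * (4 / B)) - 1)) ^ k
          ≤ Real.exp (-(0.9 * L)) * Real.exp (2 * (v * a) * (a + 2)) := by gcongr
        _ ≤ Real.exp (v * a * (1 - q * a)) ^ 2 := by
          rw [← Real.exp_add, ← Real.exp_nat_mul]
          refine Real.exp_le_exp.2 ?_
          push_cast
          linarith
        _ ≤ _ := pow_le_pow_left₀ (Real.exp_nonneg _) hA₁ 2
    linarith
  · rw [le_div_iff₀ (by norm_num)]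
    refine le_trans ?_ hA₁
    have h1 : 4 / B * (101 / 4000 * (B * L)) = 0.101 * L := by field_simp; norm_num
    rw [h1]
    -- The factor 4 is paid for by the margin 0.1036 − 0.101 in the exponent, as 0.0026·L ≥ 2.
    calc Real.exp (0.101 * L) * 4 ≤ Real.exp (0.101 * L) * Real.exp (0.0026 * L) := by
          gcongr
          exact hexp2 _ (by linarith)
      _ = Real.exp (0.1036 * L) := by rw [← Real.exp_add]; ring_nf
      _ ≤ _ := by gcongr
  · have h1 : 4 / B * (B * L) = 4 * L := by field_simp
    rw [h1]
    have h3 : 4 ≤ Real.exp L := hexp2 _ (by linarith)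
    have h4 : Real.exp (4 * L) = Real.exp L * Real.exp L * Real.exp (2 * L) := by
      rw [← Real.exp_add, ← Real.exp_add]; ring_nf
    have h5 : Real.exp (2 * (v * a) * (a + 2)) ≤ Real.exp (2 * L) := by gcongr
    rw [h4]
    have h6 := Real.exp_pos (2 * L)
    have h7 : 8 ≤ Real.exp L * Real.exp L := by nlinarith
    calc 8 * _ ≤ 8 * Real.exp (2 * L) := by linarith
      _ ≤ _ := by gcongr

theorem wordMean_mdev_process_ge (hb : 1 ≤ b) {B L : ℝ} (hB : B = (b : ℝ) + 1)
    (hL : 1000 ≤ L) (hLn : L ≤ n / 1000) (hexp : Real.exp L = n) (hbn : (b : ℝ) ≤ n / L ^ 2)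
    {m : ℕ} (hm : m = ⌊1 / 100 * B ^ 2 * (n * L)⌋₊) (x₀ : Fin (n - 1)) :
    1 - (64 * Real.exp (-(0.1 * L)) + 2 * Real.exp (1 - L / 2000)) ≤ wordMean x₀ m fun c =>
      if 1 / 800 * B * L ≤ (mdev (process b c m) 1 : ℝ) then 1 else 0 := by
  have hn : (1000000 : ℝ) ≤ n := by linarith
  have hn5 : 5 ≤ n := by
    have : (5 : ℝ) ≤ n := by linarith
    exact_mod_cast this
  have hn' : (0 : ℝ) < (n : ℝ) - 1 := by linarith
  have hb1 : (1 : ℝ) ≤ b := by exact_mod_cast hb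
  have hB2 : 2 ≤ B := by linarith
  have hL0 : 0 < L := by linarith
  have hne : Nonempty (Fin (n - 1)) := ⟨x₀⟩
  have hcard : (Fintype.card (Fin (n - 1)) : ℝ) = (n : ℝ) - 1 := by
    rw [Fintype.card_fin, Nat.cast_sub (by omega), Nat.cast_one]
  set k := numMix b m with hk
  let φ : Fin n → Fin n → ℝ := fun j v =>
    if 101 / 4000 * (B * L) ≤ |(((v : ℤ) - (j : ℕ) : ℤ) : ℝ)| then 1 else 0
  have hφ0 : ∀ j v, 0 ≤ φ j v := fun j v => by simp only [φ]; split_ifs <;> norm_num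
  set N := ∑ j, chipOp^[k] (φ j) ((1 : Equiv.Perm (Fin n)) j) with hN
  -- The hypothesis b ≤ n / log² n enters here: it keeps the boundary layer of width BL a small part
  -- of [n].
  have hBL : B * L ≤ n / 500 := by
    rw [le_div_iff₀ (by positivity)] at hbn
    rw [hB]
    nlinarith
  have hNlow : Real.exp (0.1 * L) / 4 ≤ N := by
    have h1 : ∑ j ∈ Finset.univ.filter (fun j : Fin n => B * L ≤ (j : ℕ) ∧
        ((j : ℕ) : ℝ) + B * L ≤ (n : ℝ) - 1), Real.exp (-(0.9 * L)) / 2 ≤ N := by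
      refine (Finset.sum_le_sum fun j hj => ?_).trans (Finset.sum_le_sum_of_subset_of_nonneg
        (Finset.filter_subset _ _) fun j _ _ => chipOp_iterate_nonneg k (hφ0 j) _)
      have hj := (Finset.mem_filter.1 hj).2
      exact le_chipOp_iterate_numMix_tail hb hB hL hLn hm j hj.1 hj.2
    rw [Finset.sum_const, nsmul_eq_mul] at h1
    refine le_trans ?_ h1
    have h2 := card_interior_ge n (W := B * L) (by positivity)
    have h3 : (n : ℝ) / 2 * (Real.exp (-(0.9 * L)) / 2) = Real.exp (0.1 * L) / 4 := by
      rw [← hexp, show Real.exp (0.1 * L) = Real.exp L * Real.exp (-(0.9 * L)) by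
        rw [← Real.exp_add]; ring_nf]
      ring
    rw [← h3]
    gcongr
    linarith
  have hN0 : 0 < N := lt_of_lt_of_le (by positivity) hNlow
  -- An indicator equals its square, so V = N and Chebyshev gives 16/N.
  have hbad1 : wordMean x₀ m (fun c => if ∑ j, φ j (mixPart b c m j) ≤ N - N / 2 then 1 else 0) ≤
      64 * Real.exp (-(0.1 * L)) := by
    rw [wordMean_mixPart x₀ b m fun σ => if ∑ j, φ j (σ j) ≤ N - N / 2 then 1 else 0]
    refine (permOp_iterate_chebyshev hn5 k φ 1 (half_pos hN0) (V := N) (le_of_eq ?_) rfl).trans ?_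
    · rw [hN]
      refine Finset.sum_congr rfl fun j _ => ?_
      have : (fun v => φ j v ^ 2) = φ j := by
        funext v
        simp only [φ]
        split_ifs <;> norm_num
      rw [this]
    · rw [Real.exp_neg, ← div_eq_mul_inv, div_le_div_iff₀ (by positivity) (Real.exp_pos _)]
      nlinarith
  -- The allowed number of touches: 101/4000 − 24/1000 = 1/800.
  set y : ℝ := 24 / 1000 * (B * L) with hy
  let K : Fin n → (ℕ → Fin (n - 1)) → ℕ := fun j c => countIn b (touchSet b j) c m
  have hbad2 : wordMean x₀ m (fun c => 2 / N * ∑ j, Real.exp (-(0.2 * y)) *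
      (φ j (mixPart b c m j) * Real.exp (0.2 * K j c))) ≤ 2 * Real.exp (1 - L / 2000) := by
    have h1 : ∀ j, wordMean x₀ m (fun c => φ j (mixPart b c m j) * Real.exp (0.2 * K j c)) ≤
        Real.exp (2 / ((n : ℝ) - 1) * (Real.exp 0.2 - 1) * numSorts b m) *
          chipOp^[k] (φ j) ((1 : Equiv.Perm (Fin n)) j) := fun j => by
      refine (wordMean_exp_countIn_le x₀ b m (A := touchSet b j)
        (fun c c' t h => touchSet_congr b j h) (by norm_num) (p := 2 / ((n : ℝ) - 1))
        (fun c t _ => ?_) (g := fun σ => φ j (σ j)) fun σ => hφ0 _ _).trans (le_of_eq ?_)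
      · rw [hcard, div_mul_cancel₀ _ hn'.ne']
        exact_mod_cast card_touching_le _
      · congr 1
        -- A function of one chip is an additive functional whose other summands vanish.
        have := congrFun (permOp_iterate_sum k fun i v => if i = j then φ j v else 0) 1
        simp only [Finset.sum_ite_eq', Finset.mem_univ, if_true] at this
        rw [this, Finset.sum_eq_single j]
        · simp
        · intro i _ hij
          simp only [hij, if_false]
          have : ∀ l, chipOp^[l] (fun _ : Fin n => (0 : ℝ)) = fun _ => 0 := fun l => by
            induction l with
            | zero => rfl
            | succ l ih =>
              rw [Function.iterate_succ_apply, show chipOp (fun _ : Fin n => (0 : ℝ)) = fun _ => 0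
                from funext fun v => mean_const 0, ih]
          rw [this]
        · simp
    have h2 : wordMean x₀ m (fun c => 2 / N * ∑ j, Real.exp (-(0.2 * y)) *
        (φ j (mixPart b c m j) * Real.exp (0.2 * K j c))) = 2 / N * ∑ j, Real.exp (-(0.2 * y)) *
        wordMean x₀ m (fun c => φ j (mixPart b c m j) * Real.exp (0.2 * K j c)) := by
      rw [wordMean_const_mul, wordMean_sum]
      simp only [wordMean_const_mul]
    rw [h2]
    calc _ ≤ 2 / N * ∑ j, Real.exp (-(0.2 * y)) * (Real.exp (2 / ((n : ℝ) - 1) *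
          (Real.exp 0.2 - 1) * numSorts b m) * chipOp^[k] (φ j) ((1 : Equiv.Perm (Fin n)) j)) := by
          gcongr with j
          exact h1 j
      _ = 2 * Real.exp (2 / ((n : ℝ) - 1) * (Real.exp 0.2 - 1) * numSorts b m - 0.2 * y) := by
          rw [← Finset.mul_sum, ← Finset.mul_sum, ← hN,
            show ∀ u w : ℝ, Real.exp (u - w) = Real.exp (-w) * Real.exp u from fun u w => by
              rw [← Real.exp_add]; ring_nf]
          field_simp
      _ ≤ _ := by
          refine mul_le_mul_of_nonneg_left (Real.exp_le_exp.2 ?_) zero_le_two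
          have hS := (numSorts_numMix_bounds hB (by positivity) hm).1
          have he : Real.exp 0.2 - 1 ≤ 0.2215 := by
            have := Real.exp_bound' (x := 0.2) (by norm_num) (by norm_num) (n := 4) (by norm_num)
            norm_num [Finset.sum_range_succ, Nat.factorial] at this
            linarith
          have h3 : 2 / ((n : ℝ) - 1) * (Real.exp 0.2 - 1) * numSorts b m ≤
              2 / ((n : ℝ) - 1) * 0.2215 * (B * (n * L) / 100 + 1) := by gcongr
          have h4 : 2 / ((n : ℝ) - 1) * 0.2215 * (B * (n * L) / 100 + 1) ≤
              0.0045 * (B * L) + 1 := by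
            rw [div_mul_eq_mul_div, div_mul_eq_mul_div, div_le_iff₀ hn']
            have : 0 < B * L := by positivity
            nlinarith
          have h5 : 2 * L ≤ B * L := by gcongr
          rw [hy]
          linarith
  have hpt : ∀ c, 1 - (if ∑ j, φ j (mixPart b c m j) ≤ N - N / 2 then 1 else 0) -
      2 / N * ∑ j, Real.exp (-(0.2 * y)) * (φ j (mixPart b c m j) * Real.exp (0.2 * K j c)) ≤
      if 1 / 800 * B * L ≤ (mdev (process b c m) 1 : ℝ) then (1 : ℝ) else 0 := fun c => by
    have hpos : ∀ j, 0 ≤ Real.exp (-(0.2 * y)) *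
        (φ j (mixPart b c m j) * Real.exp (0.2 * K j c)) := fun j =>
      mul_nonneg (Real.exp_nonneg _) (mul_nonneg (hφ0 _ _) (Real.exp_nonneg _))
    have hpos' : 0 ≤ 2 / N * ∑ j, Real.exp (-(0.2 * y)) *
        (φ j (mixPart b c m j) * Real.exp (0.2 * K j c)) :=
      mul_nonneg (by positivity) (Finset.sum_nonneg fun j _ => hpos j)
    split_ifs with h1 h2 h2
    · linarith
    · linarith
    · linarith
    -- If no deviation is large, every displaced chip was touched more than y times and has weight
    -- at least 1; there are more than N/2 of them, so the Markov term is at least 1.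
    · have h3 : ∀ j, φ j (mixPart b c m j) ≤ Real.exp (-(0.2 * y)) *
          (φ j (mixPart b c m j) * Real.exp (0.2 * K j c)) := fun j => by
        by_cases hj : 101 / 4000 * (B * L) ≤ |(((mixPart b c m j : ℤ) - (j : ℕ) : ℤ) : ℝ)|
        · have e : φ j (mixPart b c m j) = 1 := if_pos hj
          rw [e, one_mul, ← Real.exp_add, Real.one_le_exp_iff]
          have h4 := le_mdev_process b c m j
          push_cast at hj
          have h5 : y < K j c := by
            by_contra! h5
            refine h2 (le_trans ?_ h4)
            simp only [K] at h5
            linarith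
          linarith
        · have e : φ j (mixPart b c m j) = 0 := if_neg hj
          simp [e]
      have h4 := Finset.sum_le_sum fun j (_ : j ∈ Finset.univ) => h3 j
      have h5 : 1 ≤ 2 / N * ∑ j, Real.exp (-(0.2 * y)) *
          (φ j (mixPart b c m j) * Real.exp (0.2 * K j c)) := by
        rw [div_mul_eq_mul_div, le_div_iff₀ hN0]
        linarith
      linarith
  have hfin := wordMean_mono x₀ m hpt
  rw [wordMean_sub, wordMean_sub, wordMean_const] at hfin
  linarith

end MaxDeviation

/-! ### The total deviation -/

section TotalDeviation

variable {n b : ℕ}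

theorem le_abs_bound_of_eq_one {v : ℝ} (hv1 : 0.039 ≤ v) (hv2 : v ≤ 0.04004) :
    0.025 ≤ 4 / 2 * v - 256 / 27 / 2 ^ 3 * (v + 3 * v ^ 2) := by
  nlinarith

/-- Here 0.03 beats the 0.02 lost to sorting. At B = 2 it would fail, hence the separate lemma with
0.025 in total. -/
theorem le_abs_bound_of_three_le {B v : ℝ} (hB : 3 ≤ B) (hv1 : 0.02 * ((B - 1) * B) - 0.001 ≤ v)
    (hv2 : v ≤ 0.02002 * ((B - 1) * B)) :
    0.03 * B ≤ 4 / B * v - 256 / 27 / B ^ 3 * (v + 3 * v ^ 2) := by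
  have hB0 : 0 < B := by linarith
  have h6 : 6 ≤ (B - 1) * B := by nlinarith
  have hv0 : 0 ≤ v := by linarith
  have e : 4 / B * v - 256 / 27 / B ^ 3 * (v + 3 * v ^ 2) =
      (4 * B ^ 2 * v - 256 / 27 * (v + 3 * v ^ 2)) / B ^ 3 := by field_simp
  rw [e, le_div_iff₀ (by positivity)]
  have h1 : v ^ 2 ≤ v * (0.02002 * ((B - 1) * B)) := by
    rw [sq]; exact mul_le_mul_of_nonneg_left hv2 hv0
  obtain ⟨x, rfl⟩ : ∃ x, B = 3 + x := ⟨B - 3, by ring⟩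
  have hx : 0 ≤ x := by linarith
  have h2 : 0 ≤ 4 * (3 + x) ^ 2 - 256 / 27 * (1 + 0.06006 * ((3 + x - 1) * (3 + x))) := by
    nlinarith
  have h3 := mul_le_mul_of_nonneg_right hv1 h2
  have h4 : 0.03 * (3 + x) * (3 + x) ^ 3 ≤ (0.02 * ((3 + x - 1) * (3 + x)) - 0.001) *
      (4 * (3 + x) ^ 2 - 256 / 27 * (1 + 0.06006 * ((3 + x - 1) * (3 + x)))) := by
    have hx3 : 0 ≤ x ^ 3 := by positivity
    have hx4 : 0 ≤ x ^ 4 := by positivity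
    nlinarith
  linarith

theorem wordMean_dev_process_ge (hb : 1 ≤ b) {B : ℝ} (hB : B = (b : ℝ) + 1)
    (hn : (1000000 : ℝ) ≤ n) (hBn : B ≤ n / 500) {m : ℕ} (hm : m = ⌊1 / 100 * B ^ 2 * (n : ℝ)⌋₊)
    (x₀ : Fin (n - 1)) :
    1 - (100000 / n + Real.exp (1 - n / 250)) ≤ wordMean x₀ m fun c =>
      if 1 / 1600 * B * n ≤ (dev (process b c m) 1 : ℝ) then 1 else 0 := by
  have hn5 : 5 ≤ n := by
    have : (5 : ℝ) ≤ n := by linarith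
    exact_mod_cast this
  have hn' : (0 : ℝ) < (n : ℝ) - 1 := by linarith
  have hb1 : (1 : ℝ) ≤ b := by exact_mod_cast hb
  have hB2 : 2 ≤ B := by linarith
  have hB0 : 0 < B := by linarith
  have hbB : (b : ℝ) = B - 1 := by linarith
  have hne : Nonempty (Fin (n - 1)) := ⟨x₀⟩
  have hcard : (Fintype.card (Fin (n - 1)) : ℝ) = (n : ℝ) - 1 := by
    rw [Fintype.card_fin, Nat.cast_sub (by omega), Nat.cast_one]
  obtain ⟨hS, hk1, hk2⟩ := numSorts_numMix_bounds hB (Nat.cast_nonneg n) hm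
  set k := numMix b m with hk
  obtain ⟨v, hv⟩ : ∃ v : ℝ, v = k * (2 / ((n : ℝ) - 1)) := ⟨_, rfl⟩
  have hv' : v = 2 * k / ((n : ℝ) - 1) := by rw [hv]; ring
  have hbB2 : 2 ≤ (b : ℝ) * B := by nlinarith
  have hbBn : (b : ℝ) * B * 1000000 ≤ b * B * n :=
    mul_le_mul_of_nonneg_left hn (by linarith)
  have hv1 : 0.02 * (b * B) - 0.001 ≤ v := by
    rw [hv', le_div_iff₀ hn']
    linarith
  have hv2 : v ≤ 0.02002 * (b * B) := by
    rw [hv', div_le_iff₀ hn']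
    linarith
  have hvB : v ≤ B ^ 2 / 49 := by
    rw [hbB] at hv2
    nlinarith
  have hv0 : 0 ≤ v := by rw [hv]; positivity
  let φ : Fin n → Fin n → ℝ := fun j v => |(((v : ℤ) - (j : ℕ) : ℤ) : ℝ)|
  set D := ∑ j, chipOp^[k] (φ j) ((1 : Equiv.Perm (Fin n)) j) with hD
  have hDlow : ∀ e : ℝ, 0 ≤ e → e ≤ 4 / B * v - 256 / 27 / B ^ 3 * (v + 3 * v ^ 2) →
      0.975 * n * e ≤ D := fun e he0 he => by
    have h1 : ∑ j ∈ Finset.univ.filter (fun j : Fin n => B ≤ (j : ℕ) ∧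
        ((j : ℕ) : ℝ) + B ≤ (n : ℝ) - 1), e ≤ D := by
      refine (Finset.sum_le_sum fun j hj => ?_).trans (Finset.sum_le_sum_of_subset_of_nonneg
        (Finset.filter_subset _ _) fun j _ _ => chipOp_iterate_nonneg k (fun v => abs_nonneg _) _)
      have hj := (Finset.mem_filter.1 hj).2
      exact he.trans (le_chipOp_iterate_abs (by omega) k hB0 hv
        (hvB.trans (by linarith [sq_nonneg B])) j hj.1 hj.2)
    rw [Finset.sum_const, nsmul_eq_mul] at h1
    refine le_trans ?_ h1
    have h2 := card_interior_ge n hB0.le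
    gcongr
    linarith
  have hbad1 : wordMean x₀ m
      (fun c => if ∑ j, φ j (mixPart b c m j) ≤ D - B * n / 1000 then 1 else 0) ≤ 100000 / n := by
    rw [wordMean_mixPart x₀ b m fun σ => if ∑ j, φ j (σ j) ≤ D - B * n / 1000 then 1 else 0]
    refine (permOp_iterate_chebyshev hn5 k φ 1 (by positivity) (V := n * v) ?_ rfl).trans ?_
    · have h1 : ∀ j ∈ Finset.univ, chipOp^[k] (fun v => φ j v ^ 2)
          ((1 : Equiv.Perm (Fin n)) j) ≤ v := fun j _ => by
        have := chipOp_iterate_sq_le (by omega : 2 ≤ n) k j j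
        simpa [φ, hv] using this
      simpa using Finset.sum_le_sum h1
    · rw [div_le_div_iff₀ (by positivity) (by positivity)]
      have h1 : (n : ℝ) ^ 2 * v ≤ n ^ 2 * (B ^ 2 / 49) := by gcongr
      have h2 : 0 ≤ (n : ℝ) ^ 2 * B ^ 2 := by positivity
      linarith
  have hdev : ∀ c, ¬ ∑ j, φ j (mixPart b c m j) ≤ D - B * n / 1000 →
      D - B * n / 1000 - 2 * countIn b (activeSet b) c m ≤ dev (process b c m) 1 := fun c hc => by
    have h1 := le_dev_process b c m
    have h2 : ∑ j, φ j (mixPart b c m j) =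
        ∑ j, |((mixPart b c m j : ℕ) : ℝ) - (j : ℕ)| := by simp [φ]
    rw [h2] at hc
    linarith [not_le.1 hc]
  -- For b = 1 twice the number of sorting steps is about 0.04·n, more than the mean displacement
  -- bound 0.975·0.025·n, so only effective steps may be counted.
  rcases Nat.lt_or_ge b 2 with hb2 | hb2
  · have hbe : b = 1 := by omega
    have hBe : B = 2 := by rw [hB, hbe]; norm_num
    have hlow : 0.975 * n * 0.025 ≤ D := by
      refine hDlow _ (by norm_num) ?_
      rw [hBe] at hv1 hv2 ⊢
      rw [hbe] at hv1 hv2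
      push_cast at hv1 hv2
      exact le_abs_bound_of_eq_one (by linarith) (by linarith)
    have hm4 : (m : ℝ) ≤ n / 25 := by
      rw [hm, hBe]
      refine (Nat.floor_le (by positivity)).trans (le_of_eq ?_)
      ring
    have hbad2 : wordMean x₀ m (fun c => Real.exp (-(0.01 * n)) *
        ((fun _ : Equiv.Perm (Fin n) => (1 : ℝ)) (mixPart b c m) *
          Real.exp (1 * countIn b (activeSet b) c m))) ≤ Real.exp (1 - n / 250) := by
      -- Up to time m ≤ n/25 at most 4t ≤ 0.16·n pairs are out of order, which is below 0.17·(n −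
      -- 1).
      have h1 := wordMean_exp_countIn_le x₀ b m (A := activeSet b)
        (fun c c' t h => activeSet_congr b h) zero_le_one (p := 0.17) (fun c t ht => by
          have h2 : ((activeSet b c t).card : ℝ) ≤ 4 * t := by
            exact_mod_cast card_activeSet_le b c t
          have h3 : (t : ℝ) ≤ m := by exact_mod_cast ht.le
          rw [hcard]
          linarith) (g := fun _ => 1) fun _ => zero_le_one
      rw [permOp_iterate_const (by omega), mul_one] at h1
      rw [wordMean_const_mul]
      refine (mul_le_mul_of_nonneg_left h1 (Real.exp_nonneg _)).trans ?_
      rw [← Real.exp_add, Real.exp_le_exp]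
      have h2 : Real.exp 1 - 1 ≤ 1.72 := by linarith [Real.exp_one_lt_d9]
      have h3 : 0.17 * (Real.exp 1 - 1) * numSorts b m ≤ 0.17 * 1.72 * (B * n / 100 + 1) := by
        gcongr
      rw [hBe] at h3
      linarith
    have hpt : ∀ c, 1 - (if ∑ j, φ j (mixPart b c m j) ≤ D - B * n / 1000 then 1 else 0) -
        Real.exp (-(0.01 * n)) * ((fun _ : Equiv.Perm (Fin n) => (1 : ℝ)) (mixPart b c m) *
          Real.exp (1 * countIn b (activeSet b) c m)) ≤
        if 1 / 1600 * B * n ≤ (dev (process b c m) 1 : ℝ) then (1 : ℝ) else 0 := fun c => by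
      have hpos : 0 < Real.exp (-(0.01 * n)) * (1 * Real.exp (1 * countIn b (activeSet b) c m)) :=
        by positivity
      split_ifs with h1 h2 h2
      · linarith
      · linarith
      · linarith
      · have h3 := hdev c h1
        rw [hBe] at h2 h3
        have h4 : 0.01 * (n : ℝ) ≤ countIn b (activeSet b) c m := by linarith
        have h5 : 1 ≤ Real.exp (-(0.01 * n)) *
            (1 * Real.exp (1 * countIn b (activeSet b) c m)) := by
          rw [one_mul, ← Real.exp_add, Real.one_le_exp_iff]
          linarith
        linarith
    have hfin := wordMean_mono x₀ m hpt
    rw [wordMean_sub, wordMean_sub, wordMean_const] at hfin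
    linarith
  · have hB3 : 3 ≤ B := by
      have : (2 : ℝ) ≤ b := by exact_mod_cast hb2
      linarith
    have hlow : 0.975 * n * (0.03 * B) ≤ D := by
      refine hDlow _ (by positivity) ?_
      rw [hbB] at hv1 hv2
      exact le_abs_bound_of_three_le hB3 hv1 hv2
    have hpt : ∀ c, 1 - (if ∑ j, φ j (mixPart b c m j) ≤ D - B * n / 1000 then 1 else 0) ≤
        if 1 / 1600 * B * n ≤ (dev (process b c m) 1 : ℝ) then (1 : ℝ) else 0 := fun c => by
      split_ifs with h1 h2 h2
      · norm_num
      · norm_num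
      · norm_num
      · have h3 := hdev c h1
        have h4 : (countIn b (activeSet b) c m : ℝ) ≤ numSorts b m := by
          exact_mod_cast countIn_le_numSorts b _ c m
        have h5 : 3 * (n : ℝ) ≤ B * n := by gcongr
        exact absurd (by linarith) h2
    have hfin := wordMean_mono x₀ m hpt
    rw [wordMean_sub, wordMean_const] at hfin
    linarith [Real.exp_pos (1 - (n : ℝ) / 250)]

end TotalDeviation

/-! ### The error term and the conclusion -/

/-- A bound for the probability that the deviations are small. -/
noncomputable def errorBound (n : ℕ) : ℝ :=
  if 1000 ≤ Real.log n ∧ Real.log n ≤ n / 1000 then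
    (64 * Real.exp (-(0.1 * Real.log n)) + 2 * Real.exp (1 - Real.log n / 2000)) +
      (100000 / n + Real.exp (1 - n / 250))
  else 1

theorem tendsto_errorBound : Tendsto errorBound atTop (𝓝 0) := by
  have hn : Tendsto (fun n : ℕ => (n : ℝ)) atTop atTop := tendsto_natCast_atTop_atTop
  have hlog : Tendsto (fun n : ℕ => Real.log n) atTop atTop := Real.tendsto_log_atTop.comp hn
  have h1 : ∀ᶠ n : ℕ in atTop, 1000 ≤ Real.log n := hlog.eventually_ge_atTop 1000
  have h2 : ∀ᶠ n : ℕ in atTop, Real.log n ≤ n / 1000 := by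
    have := hn.eventually (Real.isLittleO_log_id_atTop.bound (by norm_num : (0 : ℝ) < 1 / 1000))
    filter_upwards [this] with n h
    refine (le_abs_self _).trans ?_
    simpa [div_eq_inv_mul] using h
  have h3 : Tendsto (fun n : ℕ => (64 * Real.exp (-(0.1 * Real.log n)) +
      2 * Real.exp (1 - Real.log n / 2000)) + (100000 / (n : ℝ) + Real.exp (1 - n / 250))) atTop
      (𝓝 ((64 * 0 + 2 * 0) + (0 + 0))) := by
    have e : ∀ (a c : ℝ), 0 < c → ∀ f : ℕ → ℝ, Tendsto f atTop atTop →
        Tendsto (fun n => Real.exp (a - c * f n)) atTop (𝓝 0) := fun a c hc f hf => by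
      refine Real.tendsto_exp_atBot.comp ?_
      simp only [sub_eq_add_neg]
      exact tendsto_atBot_add_const_left _ a (tendsto_neg_atTop_atBot.comp (hf.const_mul_atTop hc))
    refine Tendsto.add (Tendsto.add (Tendsto.const_mul _ ?_) (Tendsto.const_mul _ ?_))
      (Tendsto.add (hn.const_div_atTop _) ?_)
    · simpa using e 0 0.1 (by norm_num) _ hlog
    · refine (e 1 (1 / 2000) (by norm_num) _ hlog).congr fun n => ?_
      congr 2; ring
    · refine (e 1 (1 / 250) (by norm_num) _ hn).congr fun n => ?_
      congr 2; ring
  have h4 : ((64 * 0 + 2 * 0) + (0 + 0) : ℝ) = 0 := by norm_num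
  rw [h4] at h3
  refine h3.congr' ?_
  filter_upwards [h1, h2] with n ha hb
  rw [errorBound, if_pos ⟨ha, hb⟩]

end NaiveSort

theorem mainTheorem4 :
    ∃ δ : ℕ → ℝ, Tendsto δ atTop (𝓝 0) ∧
      ∀ (n b : ℕ), 2 ≤ n → 1 ≤ b → (b : ℝ) ≤ (n : ℝ) / Real.log n ^ 2 →
      ∀ (Ω : Type*) [MeasurableSpace Ω] (μ : Measure Ω) [IsProbabilityMeasure μ]
        (I : ℕ → Ω → Fin (n - 1)),
        (∀ t, Measurable (I t)) → iIndepFun I μ →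
        (∀ t i, μ.real {ω | I t ω = i} = 1 / ((n : ℝ) - 1)) →
        1 - δ n ≤ μ.real {ω | ∃ t : ℕ, 1 ≤ t ∧
            (t : ℝ) ≤ 1 / 100 * ((b : ℝ) + 1) ^ 2 * n * Real.log n ∧
            1 / 800 * ((b : ℝ) + 1) * Real.log n ≤
              (NaiveSort.mdev (NaiveSort.process b (fun s => I s ω) t) 1 : ℝ)} ∧
        1 - δ n ≤ μ.real {ω |
            1 / 1600 * ((b : ℝ) + 1) * n ≤
              (NaiveSort.dev (NaiveSort.process b (fun s => I s ω)
                ⌊1 / 100 * ((b : ℝ) + 1) ^ 2 * n⌋₊) 1 : ℝ)} := by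
  refine ⟨NaiveSort.errorBound, NaiveSort.tendsto_errorBound, ?_⟩
  intro n b hn hb hbn Ω _ μ _ I hI hind hunif
  by_cases h : 1000 ≤ Real.log n ∧ Real.log n ≤ n / 1000
  swap
  -- For these n the error bound is 1 and nothing is claimed beyond nonnegativity.
  · rw [NaiveSort.errorBound, if_neg h, sub_self]
    exact ⟨measureReal_nonneg, measureReal_nonneg⟩
  rw [NaiveSort.errorBound, if_pos h]
  have hn6 : (1000000 : ℝ) ≤ n := by linarith [h.1, h.2]
  have hexp : Real.exp (Real.log n) = n := Real.exp_log (by linarith)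
  have hunif' : ∀ t i, μ.real {ω | I t ω = i} = 1 / (Fintype.card (Fin (n - 1)) : ℝ) := by
    intro t i
    rw [hunif, Fintype.card_fin, Nat.cast_sub (by omega), Nat.cast_one]
  have hBn : (b : ℝ) + 1 ≤ n / 500 := by
    have : (n : ℝ) / Real.log n ^ 2 ≤ n / 1000 ^ 2 := by gcongr; exact h.1
    linarith
  have hb1 : (1 : ℝ) ≤ b := by exact_mod_cast hb
  let x₀ : Fin (n - 1) := ⟨0, by omega⟩
  have hlog : 0 ≤ Real.log n := by linarith [h.1]
  constructor
  -- The union over times is bounded below by its last event, t = ⌊m⌋.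
  · refine le_trans ?_ ((NaiveSort.wordMean_mdev_process_ge hb rfl h.1 h.2 hexp hbn rfl x₀).trans
      (NaiveSort.wordMean_le_measureReal μ I hI hind hunif' x₀
        ⌊1 / 100 * ((b : ℝ) + 1) ^ 2 * (n * Real.log n)⌋₊ _ (fun c c' hc => ?_) _ fun ω hω =>
          ⟨_, ?_, ?_, hω⟩))
    · have h1 : 0 ≤ 100000 / (n : ℝ) := by positivity
      linarith [Real.exp_pos (1 - (n : ℝ) / 250)]
    · rw [NaiveSort.process_congr b hc]
    · refine Nat.le_floor ?_
      have h1 : (1 : ℝ) ≤ ((b : ℝ) + 1) ^ 2 := one_le_pow₀ (by linarith)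
      have h2 : 1000000 * 1000 ≤ (n : ℝ) * Real.log n := by gcongr; exact h.1
      push_cast
      nlinarith
    · refine (Nat.floor_le (by positivity)).trans (le_of_eq ?_)
      ring
  · refine le_trans ?_ ((NaiveSort.wordMean_dev_process_ge hb rfl hn6 hBn rfl x₀).trans
      (NaiveSort.wordMean_le_measureReal μ I hI hind hunif' x₀ _ _ (fun c c' hc => ?_) _ fun ω hω =>
        hω))
    · linarith [Real.exp_pos (-(0.1 * Real.log n)), Real.exp_pos (1 - Real.log n / 2000)]
    · rw [NaiveSort.process_congr b hc]
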